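/- **Setting.** All quantum systems are finite-dimensional; a party that communicates classically is a sequence of quantum instruments, one per round. A function of the security parameter $n$ is negligible if it tends to $0$ faster than every inverse polynomial. Angles are multiples of $\pi/4$ modulo $2\pi$, and $|+_\theta\rangle=\frac1{\sqrt2}(|0\rangle+e^{i\theta}|1\rangle)$. *The sub-protocol.* $(P_A,P_B)=(P_A^{(n)},P_B^{(n)})_n$ is a family of two-party protocols over a classical channel $\mathcal C$, with any number of rounds, in which $P_A$ outputs an angle $\theta\in\mathbb Z\frac\pi4$ and $P_B$ outputs a qubit. For a run, given by the transcript and $\theta$, let $\rho_B$ be the state of this qubit with everything else traced out. The protocol is assumed correct: there are negligible $\mu,\nu$ such that for every $n$, with probability at least $1-\nu(n)$ over the runs, the trace distance between $\rho_B$ and $|+_\theta\rangle\langle+_\theta|$ is at most $\mu(n)$. Nothing is assumed about its security. *The blind computation protocol.* Fix a graph $G$ on qubits $1,\dots,N$, measured in this order, with $X$- and $Z$-dependency sets $D_v,D'_v\subseteq\{1,\dots,v-1\}$ and a non-empty set $O$ of output qubits. In $(\pi^G_A,\pi^G_B)$ the client $\pi^G_A$ gets as input the computation angles $\phi_v\in\mathbb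 Z\frac\pi4$. The parties run $N$ instances of $(P_A,P_B)$ in parallel, which give the client $\theta_v$ and the server $N$ qubits; the honest server applies controlled-$Z$ along the edges of $G$. Then, for $v=1,\dots,N$, the client picks a uniform bit $r_v$ and sends $\delta_v=\phi'_v+\theta_v+r_v\pi$, where $\phi'_v=(-1)^{s^X_v}\phi_v+s^Z_v\pi$, $s^X_v=\bigoplus_{u\in D_v}\bar s_u$, $s^Z_v=\bigoplus_{u\in D'_v}\bar s_u$; the honest server measures qubit $v$ in the basis $\{|+_{\delta_v}\rangle,|-_{\delta_v}\rangle\}$ and returns the outcome $s_v$, and the client sets $\bar s_v=s_v\oplus r_v$. The client outputs $(\bar s_v)_{v\in O}$. *The ideal resource* $\mathcal S^G_{UBQC}$ takes $\phi=(\phi_v)_v$ at the client interface. At the server interface it takes either $c=0$, or $c=1$ with a quantum state $\rho$ and a description of a CPTP map $\xi$ with classical output in $\{0,1\}^O$; it outputs nothing there. At the client interface it outputs the bits $\bar s_O$: if $c=0$, the output of the computation, i.e. of measuring the graph state of $G$ adaptively at the angles $\phi'_v$; if $c=1$, the bits $\xi(\rho,\phi)$. The filter $\vdash^{c=0}$ inputs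 $c=0$. *Security notions.* A distinguisher interacts with a resource at both interfaces and outputs a bit; its advantage between two resources is the difference of its probabilities of outputting $1$. Write $\mathcal R\approx\mathcal R'$ if every family of distinguishers of the class under consideration has negligible advantage. The class is that of all distinguishers (information-theoretic case), or that of the distinguishers run by (non-uniform) quantum circuits with polynomially many rounds, qubits and two-qubit gates (computational case). The protocol securely constructs $\mathcal S^G_{UBQC}$ from $\mathcal C$ if $\pi^G_A\mathcal C\pi^G_B\approx\mathcal S^G_{UBQC}\vdash^{c=0}$, and there is a simulator $\sigma$ with $\pi^G_A\mathcal C\approx\mathcal S^G_{UBQC}\,\sigma$. **Theorem.** Let $(P_A,P_B)$ be a correct protocol as above and $G$ a fixed graph with at least one output qubit. 1. There is no simulator $\sigma$ (of any complexity) with $\pi^G_A\mathcal C\approx\mathcal S^G_{UBQC}\,\sigma$ in the information-theoretic sense. Hence $(\pi^G_A,\pi^G_B)$ does not securely construct $\mathcal S^G_{UBQC}$ from $\mathcal C$. 2. If $P_B$ is run by circuits of polynomial size, then also in the computational sense there is no simulator $\sigma$ (of any complexity) with $\pi^G_A\mathcal C\approx\mathcal S^G_{UBQC}\,\sigma$,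 and $(\pi^G_A,\pi^G_B)$ does not securely construct $\mathcal S^G_{UBQC}$ from $\mathcal C$. -/

import Mathlib

open scoped Matrix

noncomputable section

namespace UBQC

/-! ### Registers, quantum instruments, negligible functions -/

/-- Bit strings indexed by `α`; also the computational basis of a register of qubits indexed by
`α`, so that a state of that register is a matrix indexed by `Bits α`. -/
abbrev Bits (α : Type) : Type := α → Bool

/-- A register of `q` qubits. Every finite-dimensional memory embeds into such a register. -/
abbrev Reg (q : ℕ) : Type := Bits (Fin q)

/-- The state `|0…0⟩⟨0…0|`. -/
def zeroState (q : ℕ) : Matrix (Reg q) (Reg q) ℂ :=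
  Matrix.of fun a b => if a = (fun _ => false) ∧ b = (fun _ => false) then 1 else 0

/-- A quantum instrument from `ℂ^H` to `ℂ^K` with classical outcomes in `Y`: a family of completely
positive maps (in operator-sum form) whose sum is trace preserving. `map y ρ` is the state after
outcome `y`, multiplied by the probability of `y`. -/
structure Instrument (H K Y : Type) [Fintype H] [DecidableEq H] [Fintype K] [Fintype Y] where
  map : Y → Matrix H H ℂ → Matrix K K ℂ
  isInstrument : ∃ (ι : Type) (_ : Fintype ι) (A : Y → ι → Matrix K H ℂ),
    (∑ y, ∑ i, (A y i)ᴴ * A y i = 1) ∧ ∀ y ρ, map y ρ = ∑ i, A y i * ρ * (A y i)ᴴ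

/-- A CPTP map is an instrument with a single outcome. -/
abbrev Channel (H K : Type) [Fintype H] [DecidableEq H] [Fintype K] : Type := Instrument H K Unit

/-- `f n` tends to zero faster than every inverse polynomial. -/
def Negligible (f : ℕ → ℝ) : Prop :=
  Asymptotics.SuperpolynomialDecay Filter.atTop (fun n : ℕ => (n : ℝ)) f

/-! ### Angles, the states `|+_θ⟩`, trace distance -/

/-- The angle `k π / 4` is represented by `k : ZMod 8`; the angle `π` is `4`. -/
abbrev Angle : Type := ZMod 8

/-- Three-bit binary encoding of an angle. -/
def angleBits (k : Angle) : Bits (Fin 3) := fun i => k.val.testBit i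

/-- The angle `b π`. -/
def flipAngle (b : Bool) : Angle := if b then 4 else 0

/-- The vector `|+_θ⟩ = (|0⟩ + e^{iθ} |1⟩) / √2`. Note that `|-_θ⟩ = |+_{θ+π}⟩`. -/
def plusKet (θ : Angle) : Bool → ℂ := fun b =>
  (1 / (Real.sqrt 2 : ℂ)) *
    (if b then Complex.exp (((θ.val : ℝ) * (Real.pi / 4) : ℝ) * Complex.I) else 1)

/-- The density matrix `|+_θ⟩⟨+_θ|`. -/
def plusState (θ : Angle) : Matrix Bool Bool ℂ := Matrix.vecMulVec (plusKet θ) (star (plusKet θ))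

/-- The trace norm, i.e. the sum of the singular values. -/
def traceNorm {H : Type} [Fintype H] [DecidableEq H] (A : Matrix H H ℂ) : ℝ :=
  ∑ i, Real.sqrt ((Matrix.isHermitian_conjTranspose_mul_self A).eigenvalues i)

def traceDistance {H : Type} [Fintype H] [DecidableEq H] (ρ σ : Matrix H H ℂ) : ℝ :=
  (1 / 2) * traceNorm (ρ - σ)

/-! ### Quantum circuits -/

/-- A two-qubit gate acting on two distinct qubits of the register `W`. -/
structure Gate (W : Type) where
  fst : W
  snd : W
  ne : fst ≠ snd
  mat : Matrix (Bool × Bool) (Bool × Bool) ℂ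
  unitary : mat ∈ Matrix.unitaryGroup (Bool × Bool) ℂ

def Gate.toMatrix {W : Type} [Fintype W] [DecidableEq W] (g : Gate W) :
    Matrix (Bits W) (Bits W) ℂ := Matrix.of fun a b =>
  if ∀ w, w ≠ g.fst → w ≠ g.snd → a w = b w then
    g.mat (a g.fst, a g.snd) (b g.fst, b g.snd)
  else 0

/-- A circuit is a list of gates; the first gate of the list is applied first. -/
abbrev Circuit (W : Type) : Type := List (Gate W)

def Circuit.toMatrix {W : Type} [Fintype W] [DecidableEq W] (C : Circuit W) :
    Matrix (Bits W) (Bits W) ℂ :=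
  C.foldr (fun g U => U * g.toMatrix) 1

/-- One round of a circuit machine: the classical input `x` is written into the register `α`, the
output register `β` is set to zero, `C` is run on these and on the `q` qubits of work memory, the
register `β` is measured with result `y`, and `α` is traced out. -/
def Circuit.roundMap {α β : Type} [Fintype α] [DecidableEq α] [Fintype β] [DecidableEq β] {q : ℕ}
    (C : Circuit (α ⊕ β ⊕ Fin q)) (x : Bits α) (y : Bits β) (ρ : Matrix (Reg q) (Reg q) ℂ) :
    Matrix (Reg q) (Reg q) ℂ :=
  ∑ a : Bits α,
    let K : Matrix (Reg q) (Reg q) ℂ := Matrix.of fun w' w =>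
      C.toMatrix (Sum.elim a (Sum.elim y w')) (Sum.elim x (Sum.elim (fun _ => false) w))
    K * ρ * Kᴴ

/-- Final quantum output of a circuit machine: an output qubit is set to zero, `C` is run on it and
on the work memory, and the work memory is traced out. -/
def Circuit.outputMap {q : ℕ} (C : Circuit (Unit ⊕ Fin q)) (ρ : Matrix (Reg q) (Reg q) ℂ) :
    Matrix Bool Bool ℂ :=
  ∑ w' : Reg q,
    let K : Matrix Bool (Reg q) ℂ := Matrix.of fun b w =>
      C.toMatrix (Sum.elim (fun _ => b) w') (Sum.elim (fun _ => false) w)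
    K * ρ * Kᴴ

/-! ### Classical-channel protocols for remote state preparation

In each of `L` rounds the client sends an `m`-bit string and the server answers with an `m`-bit
string. Either message may be a dummy. As the two parties exchange only classical messages, their
joint unnormalised state, for a fixed transcript, is the tensor product of the states computed
separately by the two parties. -/

/-- The converter `P_A`: a sequence of quantum instruments, ending with the classical output `θ`. -/
structure RSPClient (L m : ℕ) where
  qubits : ℕ
  send : Fin L → Instrument (Reg qubits) (Reg qubits) (Bits (Fin m))
  receive : Fin L → Bits (Fin m) → Channel (Reg qubits) (Reg qubits)
  output : Instrument (Reg qubits) Unit Angle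

/-- The converter `P_B`: a sequence of quantum instruments, ending with the output of one qubit. -/
structure RSPServer (L m : ℕ) where
  qubits : ℕ
  respond : Fin L → Bits (Fin m) → Instrument (Reg qubits) (Reg qubits) (Bits (Fin m))
  output : Channel (Reg qubits) Bool

/-- Probability that the client sends `x` and outputs `θ`, when it is fed the answers `y`. -/
def RSPClient.weight {L m : ℕ} (A : RSPClient L m) (x y : Fin L → Bits (Fin m)) (θ : Angle) : ℝ :=
  (A.output.map θ (Fin.foldl L
    (fun ρ t => (A.receive t (y t)).map () ((A.send t).map (x t) ρ))
    (zeroState A.qubits))).trace.re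

/-- The output qubit of the server, when it is fed the messages `x`, multiplied by the probability
that it answers `y`. -/
def RSPServer.qubit {L m : ℕ} (B : RSPServer L m) (x y : Fin L → Bits (Fin m)) :
    Matrix Bool Bool ℂ :=
  B.output.map () (Fin.foldl L (fun ρ t => (B.respond t (x t)).map (y t) ρ) (zeroState B.qubits))

/-- The server is run by circuits, and the total number of rounds, bits per message, qubits and
gates is at most `s`. -/
def RSPServer.HasSize {L m : ℕ} (B : RSPServer L m) (s : ℕ) : Prop :=
  ∃ (C : Fin L → Circuit (Fin m ⊕ Fin m ⊕ Fin B.qubits)) (C' : Circuit (Unit ⊕ Fin B.qubits)),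
    (∀ t x y ρ, (B.respond t x).map y ρ = (C t).roundMap x y ρ) ∧
    (∀ ρ, B.output.map () ρ = C'.outputMap ρ) ∧
    L + m + B.qubits + ∑ t, (C t).length + C'.length ≤ s

structure RSPProtocol where
  rounds : ℕ
  len : ℕ
  client : RSPClient rounds len
  server : RSPServer rounds len

open Classical in
/-- Probability, over the runs of `P_A 𝒞 P_B` (given by the transcript `x`, `y` and the output
`θ`), that the state `ρ_B` of the qubit output by `P_B` in that run is within trace distance `μ` of
`|+_θ⟩⟨+_θ|`. -/
def RSPProtocol.probClose (P : RSPProtocol) (μ : ℝ) : ℝ :=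
  ∑ x : Fin P.rounds → Bits (Fin P.len), ∑ y : Fin P.rounds → Bits (Fin P.len), ∑ θ : Angle,
    if traceDistance (((P.server.qubit x y).trace)⁻¹ • P.server.qubit x y) (plusState θ) ≤ μ then
      P.client.weight x y θ * (P.server.qubit x y).trace.re
    else 0

/-- With overwhelming probability, the trace distance between `ρ_B` and `|+_θ⟩⟨+_θ|` is
negligible. -/
def IsCorrectRSP (P : ℕ → RSPProtocol) : Prop :=
  ∃ μ ν : ℕ → ℝ, Negligible μ ∧ Negligible ν ∧ ∀ n, 1 - ν n ≤ (P n).probClose (μ n)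

/-- The server of the protocol is run by polynomial-size circuits. -/
def HasPolySizeServer (P : ℕ → RSPProtocol) : Prop :=
  ∃ p : Polynomial ℕ, ∀ n, (P n).server.HasSize (p.eval n)

/-! ### Measurement-based computation on a graph -/

/-- A graph on the qubits `0, …, N-1`, measured in this order, with the `X` and `Z` dependency sets
of each qubit (sets of qubits that are measured earlier) and the set of output qubits. -/
structure Pattern (N : ℕ) where
  graph : SimpleGraph (Fin N)
  xDep : Fin N → Finset (Fin N)
  zDep : Fin N → Finset (Fin N)
  xDep_lt : ∀ v, ∀ u ∈ xDep v, u < v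
  zDep_lt : ∀ v, ∀ u ∈ zDep v, u < v
  outputs : Finset (Fin N)

/-- The client's output: one bit for each output qubit. -/
abbrev Pattern.Outcome {N : ℕ} (G : Pattern N) : Type := Bits {v : Fin N // v ∈ G.outputs}

/-- The sum of the bits of `s` over `D`; only its parity matters below. -/
def parityCount {N : ℕ} (D : Finset (Fin N)) (s : Fin N → Bool) : ℕ :=
  ∑ u ∈ D, if s u then 1 else 0

/-- The corrected angle `φ'_v = (-1)^{s^X_v} φ_v + s^Z_v π`, given the outcomes `s`. -/
def Pattern.corrected {N : ℕ} (G : Pattern N) (φ : Fin N → Angle) (s : Fin N → Bool) (v : Fin N) :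
    Angle :=
  (-1) ^ parityCount (G.xDep v) s * φ v + 4 * (parityCount (G.zDep v) s : Angle)

open Classical in
/-- The diagonal of the product of the controlled-`Z` gates along the edges of the graph. -/
def Pattern.czSign {N : ℕ} (G : Pattern N) (b : Bits (Fin N)) : ℂ :=
  ∏ u, ∏ v, if u < v ∧ G.graph.Adj u v ∧ b u = true ∧ b v = true then -1 else 1

/-- The graph state: controlled-`Z` gates along all edges, applied to `|+⟩^{⊗N}`. -/
def Pattern.graphState {N : ℕ} (G : Pattern N) : Bits (Fin N) → ℂ :=
  fun b => G.czSign b * ∏ v, plusKet 0 (b v)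

/-- The product vector of which the projector corresponds to measuring each qubit `v` in the basis
`{|+_{δ_v}⟩, |-_{δ_v}⟩}` with outcome `s_v`. -/
def measurementKet {N : ℕ} (δ : Fin N → Angle) (s : Fin N → Bool) : Bits (Fin N) → ℂ :=
  fun b => ∏ v, plusKet (δ v + flipAngle (s v)) (b v)

/-- Probability that the honest computation specified by the angles `φ` on the graph, i.e. the
measurement of the graph state at the adaptively corrected angles, yields the output bits `out`. -/
def Pattern.honestProb {N : ℕ} (G : Pattern N) (φ : Fin N → Angle) (out : G.Outcome) : ℝ :=
  ∑ s : Fin N → Bool,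
    if (∀ v, out v = s v.1) then
      ‖star (measurementKet (G.corrected φ s) s) ⬝ᵥ G.graphState‖ ^ 2
    else 0

/-! ### Resources

All interfaces below are classical. At the interface `A` the resource takes the angles `φ` at the
beginning and returns the output bits at the end. In between, at the interface `B`, there are
`rounds` rounds (the resource sends `x t`, then receives `y t`; each of these consists of one
`len`-bit string per qubit of the graph), followed by `angles` rounds (the resource sends an angle
`δ v`, then receives a bit `s v`). -/

structure ServerInterface where
  rounds : ℕ
  len : ℕ
  angles : ℕ

/-- The messages of one preparation round: one string of `I.len` bits for each of the `N` qubits. -/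
abbrev Msg (N : ℕ) (I : ServerInterface) : Type := Bits (Fin N × Fin I.len)

/-- A closed interface `B`. -/
abbrev ServerInterface.closed : ServerInterface := ⟨0, 0, 0⟩

/-- The interface `B` of the classical channel in the blind computation protocol. -/
abbrev RSPProtocol.iface (P : RSPProtocol) (N : ℕ) : ServerInterface := ⟨P.rounds, P.len, N⟩

/-- A resource is given by its input-output behaviour: `R φ x y δ s out` is the probability that it
emits `x`, `δ`, `out` when it is fed `φ`, `y`, `s`. -/
abbrev Resource {N : ℕ} (G : Pattern N) (I : ServerInterface) : Type :=
  (φ : Fin N → Angle) → (x y : Fin I.rounds → Msg N I) →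
  (δ : Fin I.angles → Angle) → (s : Fin I.angles → Bool) → (out : G.Outcome) → ℝ

/-- What the ideal resource receives at its interface `B`: either `c = 0`, or `c = 1` with a
description `ξ` of a deviation. The latter acts on the computation angles `φ` and on a state of `q`
qubits provided along with it, and yields the client's output bits. -/
inductive ServerInput {N : ℕ} (G : Pattern N) (q : ℕ) : Type
  | honest : ServerInput G q
  | deviate (ξ : (Fin N → Angle) → Instrument (Reg q) Unit G.Outcome) : ServerInput G q

/-- The ideal resource for blind computation on the graph: the probability of the output bits
`out`, on input `φ` at `A`, and an input with a (possibly unnormalised) state `ρ` at `B`. Nothing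
is output at `B`. -/
def idealOutput {N : ℕ} (G : Pattern N) {q : ℕ} (φ : Fin N → Angle) (c : ServerInput G q)
    (ρ : Matrix (Reg q) (Reg q) ℂ) (out : G.Outcome) : ℝ :=
  match c with
  | .honest => ρ.trace.re * G.honestProb φ out
  | .deviate ξ => ((ξ φ).map out ρ).trace.re

/-- The ideal resource with the filter `c = 0` at `B`. -/
def filteredIdeal {N : ℕ} (G : Pattern N) : Resource G .closed :=
  fun φ _ _ _ _ out => G.honestProb φ out

/-- The resource `π_A 𝒞`. The client runs one instance of `P_A` per qubit, all in parallel, and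
obtains the angles `θ v`. Then, for each qubit `v` in order, it picks a random bit `r v`, sends
`δ v = φ'_v + θ v + r v π`, receives `s v` and sets `s̄ v = s v ⊕ r v`. The output consists of
`s̄ v` for the output qubits. -/
def realResource {N : ℕ} (G : Pattern N) (P : RSPProtocol) : Resource G (P.iface N) :=
  fun φ x y δ s out =>
    ∑ θ : Fin N → Angle, ∑ r : Fin N → Bool,
      (∏ v, P.client.weight (fun t i => x t (v, i)) (fun t i => y t (v, i)) (θ v)) *
      (1 / 2) ^ N *
      (if (∀ v, δ v = G.corrected φ (fun u => xor (s u) (r u)) v + θ v + flipAngle (r v)) ∧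
          (∀ v, out v = xor (s v.1) (r v.1)) then 1 else 0)

/-- The honest server `π_B`: it runs one instance of `P_B` per qubit, applies the controlled-`Z`
gates along the edges to the qubits obtained, and measures each qubit `v` in the basis
`{|+_{δ v}⟩, |-_{δ v}⟩}`. This is the probability that it answers `y`, `s` when it is fed `x`, `δ`.
(Measurements of distinct qubits commute.) -/
def honestServer {N : ℕ} (G : Pattern N) (P : RSPProtocol)
    (x y : Fin P.rounds → Msg N (P.iface N)) (δ : Fin N → Angle) (s : Fin N → Bool) : ℝ :=
  let E : Matrix (Bits (Fin N)) (Bits (Fin N)) ℂ := Matrix.of fun a b =>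
    G.czSign a *
      (∏ v, P.server.qubit (fun t i => x t (v, i)) (fun t i => y t (v, i)) (a v) (b v)) *
      star (G.czSign b)
  (star (measurementKet δ s) ⬝ᵥ (E *ᵥ measurementKet δ s)).re

/-- The resource `π_A 𝒞 π_B`. -/
def honestRun {N : ℕ} (G : Pattern N) (P : RSPProtocol) : Resource G .closed :=
  fun φ _ _ _ _ out =>
    ∑ x : Fin P.rounds → Msg N (P.iface N), ∑ y : Fin P.rounds → Msg N (P.iface N),
    ∑ δ : Fin N → Angle, ∑ s : Fin N → Bool,
      realResource G P φ x y δ s out * honestServer G P x y δ s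

/-- A (computationally unbounded) simulator: a sequence of quantum instruments that plays the role
of the client at `B`, and finally gives an input to the ideal resource, together with its memory.
Giving this input at the very end, rather than earlier, only makes simulators more powerful. -/
structure Simulator {N : ℕ} (G : Pattern N) (I : ServerInterface) where
  qubits : ℕ
  send : Fin I.rounds → Instrument (Reg qubits) (Reg qubits) (Msg N I)
  receive : Fin I.rounds → Msg N I → Channel (Reg qubits) (Reg qubits)
  sendAngle : Fin I.angles → Instrument (Reg qubits) (Reg qubits) Angle
  receiveBit : Fin I.angles → Bool → Channel (Reg qubits) (Reg qubits)
  finalQubits : ℕ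
  choices : ℕ
  decide : Instrument (Reg qubits) (Reg finalQubits) (Fin choices)
  command : Fin choices → ServerInput G finalQubits

/-- The ideal resource with the simulator `σ` at `B`. -/
def simulated {N : ℕ} (G : Pattern N) {I : ServerInterface} (σ : Simulator G I) : Resource G I :=
  fun φ x y δ s out =>
    let ρ₁ := Fin.foldl I.rounds
      (fun ρ t => (σ.receive t (y t)).map () ((σ.send t).map (x t) ρ)) (zeroState σ.qubits)
    let ρ₂ := Fin.foldl I.angles
      (fun ρ v => (σ.receiveBit v (s v)).map () ((σ.sendAngle v).map (δ v) ρ)) ρ₁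
    ∑ z, idealOutput G φ (σ.command z) (σ.decide.map z ρ₂) out

/-! ### Distinguishers -/

/-- A distinguisher: it chooses the angles `φ` at `A`, plays the role of the server at `B`, receives
the output bits at `A` and outputs a bit. -/
structure Distinguisher {N : ℕ} (G : Pattern N) (I : ServerInterface) where
  qubits : ℕ
  choose : Instrument (Reg qubits) (Reg qubits) (Fin N → Angle)
  respond : Fin I.rounds → Msg N I → Instrument (Reg qubits) (Reg qubits) (Msg N I)
  respondAngle : Fin I.angles → Angle → Instrument (Reg qubits) (Reg qubits) Bool
  guess : G.Outcome → Instrument (Reg qubits) (Reg qubits) Bool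

/-- Probability that the distinguisher chooses `φ`, answers `y`, `s` and finally outputs `b`, when
it is fed `x`, `δ`, `out`. -/
def Distinguisher.weight {N : ℕ} {G : Pattern N} {I : ServerInterface} (D : Distinguisher G I)
    (φ : Fin N → Angle) (x y : Fin I.rounds → Msg N I) (δ : Fin I.angles → Angle)
    (s : Fin I.angles → Bool) (out : G.Outcome) (b : Bool) : ℝ :=
  let ρ₁ := Fin.foldl I.rounds (fun ρ t => (D.respond t (x t)).map (y t) ρ)
    (D.choose.map φ (zeroState D.qubits))
  let ρ₂ := Fin.foldl I.angles (fun ρ v => (D.respondAngle v (δ v)).map (s v) ρ) ρ₁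
  ((D.guess out).map b ρ₂).trace.re

/-- Probability that the distinguisher outputs `1` in the interaction with the resource `R`. -/
def Distinguisher.accept {N : ℕ} {G : Pattern N} {I : ServerInterface} (D : Distinguisher G I)
    (R : Resource G I) : ℝ :=
  ∑ φ : Fin N → Angle, ∑ x : Fin I.rounds → Msg N I, ∑ y : Fin I.rounds → Msg N I,
  ∑ δ : Fin I.angles → Angle, ∑ s : Fin I.angles → Bool, ∑ out : G.Outcome,
    R φ x y δ s out * D.weight φ x y δ s out true

/-- The statistical distance between the output bits of the distinguisher on `R` and on `S`. -/
def Distinguisher.advantage {N : ℕ} {G : Pattern N} {I : ServerInterface} (D : Distinguisher G I)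
    (R S : Resource G I) : ℝ := |D.accept R - D.accept S|

/-- The distinguisher is run by circuits, and the total number of rounds, bits per message, qubits
and gates is at most `k`. -/
def Distinguisher.HasSize {N : ℕ} {G : Pattern N} {I : ServerInterface} (D : Distinguisher G I)
    (k : ℕ) : Prop :=
  ∃ (C₁ : Circuit (Empty ⊕ (Fin N × Fin 3) ⊕ Fin D.qubits))
    (C₂ : Fin I.rounds → Circuit ((Fin N × Fin I.len) ⊕ (Fin N × Fin I.len) ⊕ Fin D.qubits))
    (C₃ : Fin I.angles → Circuit (Fin 3 ⊕ Unit ⊕ Fin D.qubits))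
    (C₄ : Circuit ({v : Fin N // v ∈ G.outputs} ⊕ Unit ⊕ Fin D.qubits)),
    (∀ φ ρ, D.choose.map φ ρ = C₁.roundMap Empty.elim (fun i => angleBits (φ i.1) i.2) ρ) ∧
    (∀ t x y ρ, (D.respond t x).map y ρ = (C₂ t).roundMap x y ρ) ∧
    (∀ v δ s ρ, (D.respondAngle v δ).map s ρ = (C₃ v).roundMap (angleBits δ) (fun _ => s) ρ) ∧
    (∀ out b ρ, (D.guess out).map b ρ = C₄.roundMap out (fun _ => b) ρ) ∧
    I.rounds + N * I.len + I.angles + D.qubits +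
      C₁.length + ∑ t, (C₂ t).length + ∑ v, (C₃ v).length + C₄.length ≤ k

/-- The two classes of distinguishers: all of them, or those run by polynomial-size circuits. -/
inductive Power : Type
  | unbounded : Power
  | polynomial : Power

/-- The families of distinguishers in the given class, indexed by the security parameter. -/
def Power.Allows (κ : Power) {N : ℕ} {G : Pattern N} {I : ℕ → ServerInterface}
    (D : ∀ n, Distinguisher G (I n)) : Prop :=
  match κ with
  | .unbounded => True
  | .polynomial => ∃ p : Polynomial ℕ, ∀ n, (D n).HasSize (p.eval n)

/-- `R` and `S` are indistinguishable up to a negligible advantage, for the given class. (For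
unbounded distinguishers this says that the supremum of the advantages is negligible. The negligible
bound may depend on the family of distinguishers, which makes the notion weaker, hence its failure
stronger, than with a single bound.) -/
def Indistinguishable (κ : Power) {N : ℕ} {G : Pattern N} {I : ℕ → ServerInterface}
    (R S : ∀ n, Resource G (I n)) : Prop :=
  ∀ D : ∀ n, Distinguisher G (I n), κ.Allows D →
    Negligible fun n => (D n).advantage (R n) (S n)

/-- `σ` is a simulator for the blind computation protocol on `G` that uses `P`:
`π_A 𝒞 ≈ S_UBQC σ`. -/
def IsSimulatorFor (κ : Power) {N : ℕ} (G : Pattern N) (P : ℕ → RSPProtocol)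
    (σ : ∀ n, Simulator G ((P n).iface N)) : Prop :=
  Indistinguishable κ (fun n => realResource G (P n)) (fun n => simulated G (σ n))

/-- The blind computation protocol on `G` that uses `P` securely constructs the ideal resource from
the classical channel: availability `π_A 𝒞 π_B ≈ S_UBQC ⊢`, and security. -/
def SecurelyConstructs (κ : Power) {N : ℕ} (G : Pattern N) (P : ℕ → RSPProtocol) : Prop :=
  Indistinguishable κ (I := fun _ => .closed)
    (fun n => honestRun G (P n)) (fun _ => filteredIdeal G) ∧
  ∃ σ : ∀ n, Simulator G ((P n).iface N), IsSimulatorFor κ G P σ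

end UBQC

end

noncomputable section

namespace UBQC

open scoped ComplexOrder

/-! ### Instruments -/

section Instruments

variable {H K Y : Type} [Fintype H] [DecidableEq H] [Fintype K] [Fintype Y]

/-! The proof turns on the fact that the simulator must produce the whole conversation at `B`
without knowing the computation angles, while the client's output must agree with a measurement
whose basis depends on them.

Fix an output qubit `w`. The distinguisher inputs the angle 0 on every qubit, or 0 everywhere except
π/2 on `w`; call these two attacks `c = false` and `c = true`. At `B` it runs the honest `P_B` for
every qubit but applies no entangling gates. It measures qubit `v` in the basis `|±_{δ_v - φ_v}⟩`,
announces the result for `v < w`, and announces 0 from `w` on. It accepts if the client's output bit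
at `w` equals the unannounced result at `w`.

With the real client and an ideal preparation, qubit `v < w` is `|+_{θ_v}⟩` and the result is
exactly `r_v`. So `s̄_v = 0`, no corrections arise up to `w`, the result at `w` is `r_w`, and the
client outputs `0 ⊕ r_w`. For an imperfect preparation the acceptance probability is still at least
the `N`-th power of the expected fidelity (`fidelity_pow_le_accept_realResource`), which tends to 1
for a correct protocol.

In the ideal world, fix the transcript. The simulator's memory and the distinguisher's qubits are
then in a product state, and the transcript has the same probability in both attacks, since the
result at `w` is not announced. The output bit is therefore only a guess at the result of measuring
a fixed qubit state, in one of two mutually unbiased bases according to `c`. The two success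
probabilities add up to at most 1 + 1/√2 < 9/5 (`overlap_add_overlap_le`,
`accept_simulated_add_le`). In the real world they add up to nearly 2, so the two advantages cannot
both be negligible. The complexity of the simulator plays no role.

For the computational statement the attack must be run by polynomial-size circuits. It is therefore
organised into one block of memory per qubit, and its analysis uses only the interface
`Blocks.Realizes`. That interface is met by an operator-sum construction for an arbitrary server,
and by explicit circuits when the server is a circuit (`circuitBlocks_realizes`,
`distinguisher_hasSize`). -/

theorem Instrument.posSemidef (F : Instrument H K Y) (y : Y) {ρ : Matrix H H ℂ}
    (h : ρ.PosSemidef) : (F.map y ρ).PosSemidef := by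
  obtain ⟨ι, _, A, -, hA⟩ := F.isInstrument
  rw [hA]
  exact Matrix.posSemidef_sum _ fun i _ => h.mul_mul_conjTranspose_same _

theorem Instrument.sum_trace (F : Instrument H K Y) (ρ : Matrix H H ℂ) :
    ∑ y, (F.map y ρ).trace = ρ.trace := by
  obtain ⟨ι, _, A, h1, hA⟩ := F.isInstrument
  calc ∑ y, (F.map y ρ).trace
      = ∑ y, ∑ i, ((A y i)ᴴ * A y i * ρ).trace := by
        refine Finset.sum_congr rfl fun y _ => ?_
        rw [hA, Matrix.trace_sum]
        refine Finset.sum_congr rfl fun i _ => ?_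
        rw [Matrix.trace_mul_comm, Matrix.mul_assoc]
    _ = ((∑ y, ∑ i, (A y i)ᴴ * A y i) * ρ).trace := by
        simp only [Finset.sum_mul, Matrix.trace_sum]
    _ = ρ.trace := by rw [h1, one_mul]

theorem Instrument.trace_channel (F : Channel H K) (ρ : Matrix H H ℂ) :
    (F.map () ρ).trace = ρ.trace := by
  simpa using F.sum_trace ρ

end Instruments

/-! ### Iterated instruments and the total weight of transcripts. -/

theorem posSemidef_foldl {H : Type} [Fintype H] {L : ℕ}
    (f : Matrix H H ℂ → Fin L → Matrix H H ℂ)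
    (hf : ∀ ρ t, ρ.PosSemidef → (f ρ t).PosSemidef) {ρ : Matrix H H ℂ} (h : ρ.PosSemidef) :
    (Fin.foldl L f ρ).PosSemidef := by
  induction L generalizing ρ with
  | zero => simpa using h
  | succ L ih =>
    rw [Fin.foldl_succ]
    exact ih _ (fun ρ t => hf ρ _) (hf _ _ h)

theorem posSemidef_zeroState (q : ℕ) : (zeroState q).PosSemidef := by
  have : zeroState q = Matrix.diagonal fun a => if a = (fun _ => false) then (1 : ℂ) else 0 := by
    ext a b
    by_cases h : a = b
    · subst h; simp [zeroState]
    · simp only [zeroState, Matrix.of_apply, Matrix.diagonal_apply_ne _ h]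
      rw [if_neg]
      rintro ⟨rfl, rfl⟩
      exact h rfl
  rw [this]
  refine Matrix.PosSemidef.diagonal fun a => ?_
  dsimp only
  split_ifs <;> simp

theorem trace_zeroState (q : ℕ) : (zeroState q).trace = 1 := by
  simp [zeroState, Matrix.trace]

theorem posSemidef_re_trace_nonneg {H : Type} [Fintype H] {ρ : Matrix H H ℂ}
    (h : ρ.PosSemidef) : 0 ≤ ρ.trace.re := (Complex.le_def.1 h.trace_nonneg).1

theorem posSemidef_ofReal_trace {H : Type} [Fintype H] {ρ : Matrix H H ℂ}
    (h : ρ.PosSemidef) : (ρ.trace.re : ℂ) = ρ.trace := by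
  apply Complex.ext
  · simp
  · simpa using (Complex.le_def.1 h.trace_nonneg).2

/-- Two parties that exchange classical messages produce transcripts of total weight one. -/
theorem sum_trace_mul_trace_foldl {L : ℕ} {X Y H K : Type} [Fintype X] [Fintype Y] [Fintype H]
    [Fintype K] (a : Fin L → X → Y → Matrix H H ℂ → Matrix H H ℂ)
    (b : Fin L → X → Y → Matrix K K ℂ → Matrix K K ℂ)
    (h : ∀ t ρ σ, ∑ x, ∑ y, (a t x y ρ).trace * (b t x y σ).trace = ρ.trace * σ.trace)
    (ρ : Matrix H H ℂ) (σ : Matrix K K ℂ) :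
    ∑ x : Fin L → X, ∑ y : Fin L → Y,
      (Fin.foldl L (fun ρ t => a t (x t) (y t) ρ) ρ).trace *
      (Fin.foldl L (fun σ t => b t (x t) (y t) σ) σ).trace = ρ.trace * σ.trace := by
  induction L generalizing ρ σ with
  | zero => simp
  | succ L ih =>
    -- Both message sequences are split into the first round and the rest; the induction hypothesis
    -- is then applied to the states after that round.
    rw [← (Fin.consEquiv fun _ => X).sum_comp, Fintype.sum_prod_type]
    simp_rw [← (Fin.consEquiv fun _ => Y).sum_comp, Fintype.sum_prod_type, Fin.foldl_succ]
    simp only [Fin.consEquiv_apply, Fin.cons_zero, Fin.cons_succ]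
    rw [← h 0]
    refine Finset.sum_congr rfl fun x _ => ?_
    rw [Finset.sum_comm]
    refine Finset.sum_congr rfl fun y _ => ?_
    exact ih (fun t => a t.succ) (fun t => b t.succ) (fun t => h t.succ) _ _

/-- `receive` preserves the trace, so its dependence on the answer disappears. The sum over answers
is then complete for `respond`, and afterwards the sum over messages is complete for `send`. -/
theorem sum_trace_mul_trace_round {H K X Y : Type} [Fintype H] [DecidableEq H] [Fintype K]
    [DecidableEq K] [Fintype X] [Fintype Y] (send : Instrument H H X)
    (receive : Y → Channel H H) (respond : X → Instrument K K Y)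
    (ρ : Matrix H H ℂ) (σ : Matrix K K ℂ) :
    ∑ x, ∑ y, ((receive y).map () (send.map x ρ)).trace * ((respond x).map y σ).trace
      = ρ.trace * σ.trace := by
  simp only [Instrument.trace_channel, ← Finset.mul_sum, Instrument.sum_trace, ← Finset.sum_mul]

/-! ### The states `|+_θ⟩` -/

/-- The phase `e^{iθ}`. -/
def phase (θ : Angle) : ℂ := ZMod.stdAddChar (N := 8) θ

theorem phase_add (α β : Angle) : phase (α + β) = phase α * phase β :=
  AddChar.map_add_eq_mul _ _ _

theorem phase_eq_exp (θ : Angle) :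
    phase θ = Complex.exp (((θ.val : ℝ) * (Real.pi / 4) : ℝ) * Complex.I) := by
  rw [phase, ZMod.stdAddChar_apply, ZMod.toCircle_apply]
  congr 1
  push_cast
  ring

theorem phase_zero : phase 0 = 1 := AddChar.map_zero_eq_one _

theorem phase_two : phase 2 = Complex.I := by
  rw [phase_eq_exp]
  refine Eq.trans ?_ Complex.exp_pi_div_two_mul_I
  congr 1
  have : (ZMod.val (2 : Angle)) = 2 := rfl
  rw [this]
  push_cast
  ring

theorem phase_four : phase 4 = -1 := by
  rw [phase_eq_exp, ← Complex.exp_pi_mul_I]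
  congr 1
  have : (ZMod.val (4 : Angle)) = 4 := rfl
  rw [this]
  push_cast
  ring

theorem norm_phase (θ : Angle) : ‖phase θ‖ = 1 := by
  rw [phase_eq_exp, Complex.norm_exp_ofReal_mul_I]

theorem star_phase_mul (θ : Angle) : star (phase θ) * phase θ = 1 := by
  rw [Complex.star_def, ← Complex.normSq_eq_conj_mul_self, Complex.normSq_eq_norm_sq, norm_phase]
  simp

theorem phase_neg (θ : Angle) : phase (-θ) = star (phase θ) := by
  have h : phase (-θ) * phase θ = 1 := by rw [← phase_add]; simp [phase_zero]
  have h2 := star_phase_mul θ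
  have h3 : phase θ ≠ 0 := by
    intro h0; rw [h0] at h; simp at h
  exact mul_right_cancel₀ h3 (h.trans h2.symm)

theorem phase_flipAngle (b : Bool) : phase (flipAngle b) = if b then -1 else 1 := by
  cases b <;> simp [flipAngle, phase_zero, phase_four]

theorem plusKet_eq (θ : Angle) (b : Bool) :
    plusKet θ b = (1 / (Real.sqrt 2 : ℂ)) * (if b then phase θ else 1) := by
  rw [plusKet, phase_eq_exp]

theorem sqrt_two_mul_self : (1 / (Real.sqrt 2 : ℂ)) * (1 / (Real.sqrt 2 : ℂ)) = 1 / 2 := by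
  rw [div_mul_div_comm, ← Complex.ofReal_mul, Real.mul_self_sqrt (by norm_num)]
  norm_num

theorem star_plusKet_mul (α β : Angle) (a b : Bool) :
    star (plusKet α a) * plusKet β b
      = 1 / 2 * (star (if a then phase α else 1) * (if b then phase β else 1)) := by
  rw [plusKet_eq, plusKet_eq, star_mul', ← sqrt_two_mul_self]
  have : star (1 / (Real.sqrt 2 : ℂ)) = 1 / (Real.sqrt 2 : ℂ) := by
    simp
  rw [this]
  ring

theorem flipAngle_add_self (b : Bool) : flipAngle b + flipAngle b = 0 := by
  cases b <;> decide

theorem sum_star_plusKet_mul (α : Angle) (s s' : Bool) :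
    ∑ b, star (plusKet (α + flipAngle s) b) * plusKet (α + flipAngle s') b
      = if s = s' then 1 else 0 := by
  simp only [Fintype.sum_bool, star_plusKet_mul, phase_add, phase_flipAngle]
  have := star_phase_mul α
  cases s <;> cases s' <;> simp at this ⊢ <;>
    first | linear_combination (1 / 2) * this | linear_combination (-1 / 2) * this

/-- Completeness of the basis `|±_α⟩`, complementing the orthonormality in `sum_star_plusKet_mul`.
It gives the unitarity of `basisChange`. -/
theorem sum_star_plusKet_flip_mul (α : Angle) (a b : Bool) :
    ∑ s, star (plusKet (α + flipAngle s) a) * plusKet (α + flipAngle s) b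
      = if a = b then 1 else 0 := by
  simp only [Fintype.sum_bool, star_plusKet_mul, phase_add, phase_flipAngle]
  have := star_phase_mul α
  cases a <;> cases b <;> simp at this ⊢ <;> try linear_combination this
  all_goals norm_num

/-- The unnormalised fidelity `⟨+_θ|τ|+_θ⟩`. -/
def overlap (θ : Angle) (τ : Matrix Bool Bool ℂ) : ℂ :=
  star (plusKet θ) ⬝ᵥ (τ *ᵥ plusKet θ)

theorem overlap_eq_sum (θ : Angle) (τ : Matrix Bool Bool ℂ) :
    overlap θ τ = ∑ a, ∑ b, star (plusKet θ a) * τ a b * plusKet θ b := by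
  simp only [overlap, dotProduct, Matrix.mulVec, Finset.mul_sum, Pi.star_apply, mul_assoc]

/-- Bloch form: beyond the trace, only the off-diagonal entry rotated by the phase of `θ` matters.
Adding π flips its sign, and a shift by π/2 exchanges its real and imaginary parts up to sign. -/
theorem overlap_eq (θ : Angle) (τ : Matrix Bool Bool ℂ) :
    overlap θ τ = 1 / 2 * (τ.trace + phase θ * τ false true + star (phase θ) * τ true false) := by
  have h (a b : Bool) : star (plusKet θ a) * τ a b * plusKet θ b
      = (star (plusKet θ a) * plusKet θ b) * τ a b := by ring
  have h2 := star_phase_mul θ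
  simp only [overlap_eq_sum, h, star_plusKet_mul, Matrix.trace, Fintype.sum_bool, Matrix.diag]
  simp at h2 ⊢
  linear_combination (1 / 2 * τ true true) * h2

/-- The off-diagonal contributions of `θ` and `θ + π` cancel. Since the result does not depend on
`θ`, a measurement whose outcome stays hidden reveals nothing about its basis; this is why both
attacks produce a given transcript with the same weight. -/
theorem sum_overlap_flip (θ : Angle) (τ : Matrix Bool Bool ℂ) :
    ∑ b, overlap (θ + flipAngle b) τ = τ.trace := by
  simp only [overlap_eq, phase_add, phase_flipAngle, Fintype.sum_bool]
  simp
  ring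

theorem overlap_nonneg (θ : Angle) {τ : Matrix Bool Bool ℂ} (h : τ.PosSemidef) :
    0 ≤ overlap θ τ := h.dotProduct_mulVec_nonneg _

theorem overlap_re_nonneg (θ : Angle) {τ : Matrix Bool Bool ℂ} (h : τ.PosSemidef) :
    0 ≤ (overlap θ τ).re := (Complex.le_def.1 (overlap_nonneg θ h)).1

theorem overlap_re_le_trace (θ : Angle) {τ : Matrix Bool Bool ℂ} (h : τ.PosSemidef) :
    (overlap θ τ).re ≤ τ.trace.re := by
  have h1 := congrArg Complex.re (sum_overlap_flip θ τ)
  have h2 := overlap_re_nonneg (θ + flipAngle true) h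
  simp only [Fintype.sum_bool, Complex.add_re] at h1
  have h3 : θ + flipAngle false = θ := by simp [flipAngle]
  rw [h3] at h1
  linarith

/-- No qubit state is close to an eigenstate of two anticommuting observables. -/
theorem overlap_add_overlap_le (α : Angle) (b c : Bool) {τ : Matrix Bool Bool ℂ}
    (h : τ.PosSemidef) :
    (overlap (α + flipAngle b) τ).re + (overlap (α - 2 + flipAngle c) τ).re
      ≤ 9 / 5 * τ.trace.re := by
  have hT := posSemidef_re_trace_nonneg h
  have hh : τ true false = star (τ false true) := (h.1.apply true false).symm
  have hd : 0 ≤ τ.det := h.det_nonneg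
  have h00 : 0 ≤ τ false false := h.diag_nonneg
  have h11 : 0 ≤ τ true true := h.diag_nonneg
  -- Up to sign, the real and imaginary parts of `z` are the deviations of the two overlaps from
  -- half the trace. Positivity of the determinant bounds the norm of `z` by half the trace.
  set z := phase α * τ false true with hz
  have hzn : ‖z‖ = ‖τ false true‖ := by rw [hz, norm_mul, norm_phase, one_mul]
  have hdet : ‖τ false true‖ ^ 2 ≤ (τ false false).re * (τ true true).re := by
    have e : τ.det = τ false false * τ true true - τ false true * τ true false := by
      rw [← Matrix.det_submatrix_equiv_self finTwoEquiv, Matrix.det_fin_two]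
      rfl
    rw [e, hh] at hd
    have := (Complex.le_def.1 hd).1
    have i0 := (Complex.le_def.1 h00).2
    have i1 := (Complex.le_def.1 h11).2
    rw [Complex.sub_re, Complex.star_def, Complex.mul_conj, Complex.normSq_eq_norm_sq,
      Complex.mul_re, ← i0, ← i1] at this
    simp at this
    rw [← Complex.ofReal_pow, Complex.ofReal_re] at this
    exact this
  have ht : τ.trace.re = (τ false false).re + (τ true true).re := by
    simp [Matrix.trace, add_comm]
  have hzz : z.re ^ 2 + z.im ^ 2 = ‖z‖ ^ 2 := by
    rw [← Complex.normSq_eq_norm_sq, Complex.normSq_apply]; ring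
  have o1 : (overlap (α + flipAngle b) τ).re
      = 1 / 2 * τ.trace.re + (if b then -1 else 1) * z.re := by
    have : overlap (α + flipAngle b) τ
        = 1 / 2 * (τ.trace + (if b then -1 else 1) * (z + star z)) := by
      rw [overlap_eq, hh, phase_add, phase_flipAngle, hz]
      cases b <;> simp <;> ring
    rw [this]
    cases b <;> simp <;> ring
  have o2 : (overlap (α - 2 + flipAngle c) τ).re
      = 1 / 2 * τ.trace.re + (if c then -1 else 1) * z.im := by
    have : overlap (α - 2 + flipAngle c) τ
        = 1 / 2 * (τ.trace - (if c then -1 else 1) * Complex.I * (z - star z)) := by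
      rw [overlap_eq, hh, phase_add, phase_flipAngle, hz, sub_eq_add_neg, phase_add, phase_neg,
        phase_two]
      cases c <;> simp <;> ring
    rw [this]
    cases c <;> simp <;> ring
  rw [o1, o2]
  have k0 := (Complex.le_def.1 h00).1
  have k1 := (Complex.le_def.1 h11).1
  simp only [Complex.zero_re] at k0 k1
  -- The sharp factor is 1/√2; 4/5 is a convenient rational above it. Adding the trace from the two
  -- halves turns it into 9/5, and any constant below 2 would do.
  have key : ∀ p r T : ℝ, 0 ≤ T → p ^ 2 + r ^ 2 ≤ T ^ 2 / 4 → p + r ≤ 4 / 5 * T := by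
    intro p r T hT h
    nlinarith [sq_nonneg (p - r), sq_nonneg (p + r)]
  have hq : ∀ p r : ℝ, p ^ 2 = z.re ^ 2 → r ^ 2 = z.im ^ 2 → p + r ≤ 4 / 5 * τ.trace.re := by
    intro p r hp hr
    apply key _ _ _ hT
    rw [hp, hr, hzz, hzn, ht]
    nlinarith [sq_nonneg ((τ false false).re - (τ true true).re)]
  have := hq ((if b then -1 else 1) * z.re) ((if c then -1 else 1) * z.im)
    (by split_ifs <;> ring) (by split_ifs <;> ring)
  linarith

/-! ### Trace distance -/

/-- The Hilbert–Schmidt norm is at most the trace norm: the left side is the trace of `Aᴴ * A`, the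
sum of the squared singular values, and a sum of squares of nonnegative numbers is at most the
square of their sum. -/
theorem sum_normSq_le_traceNorm_sq {H : Type} [Fintype H] [DecidableEq H] (A : Matrix H H ℂ) :
    ∑ i, ∑ j, ‖A i j‖ ^ 2 ≤ traceNorm A ^ 2 := by
  have hA := Matrix.isHermitian_conjTranspose_mul_self A
  have hnn : ∀ i, 0 ≤ hA.eigenvalues i :=
    (Matrix.posSemidef_conjTranspose_mul_self A).eigenvalues_nonneg
  have h1 : ∑ i, hA.eigenvalues i = ∑ i, ∑ j, ‖A i j‖ ^ 2 := by
    have h := hA.trace_eq_sum_eigenvalues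
    have h2 : (Aᴴ * A).trace = ((∑ i, ∑ j, ‖A i j‖ ^ 2 : ℝ) : ℂ) := by
      rw [Finset.sum_comm]
      simp only [Matrix.trace, Matrix.diag, Matrix.mul_apply, Matrix.conjTranspose_apply]
      push_cast
      refine Finset.sum_congr rfl fun i _ => Finset.sum_congr rfl fun j _ => ?_
      rw [Complex.star_def, Complex.conj_mul']
    rw [h2] at h
    have h3 : ∑ i, ((hA.eigenvalues i : ℝ) : ℂ) = ((∑ i, ∑ j, ‖A i j‖ ^ 2 : ℝ) : ℂ) := h.symm
    exact_mod_cast h3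
  rw [← h1, traceNorm]
  calc ∑ i, hA.eigenvalues i = ∑ i, Real.sqrt (hA.eigenvalues i) ^ 2 :=
        Finset.sum_congr rfl fun i _ => (Real.sq_sqrt (hnn i)).symm
    _ ≤ _ := Finset.sum_sq_le_sq_sum_of_nonneg fun i _ => Real.sqrt_nonneg _

theorem traceNorm_nonneg {H : Type} [Fintype H] [DecidableEq H] (A : Matrix H H ℂ) :
    0 ≤ traceNorm A := Finset.sum_nonneg fun _ _ => Real.sqrt_nonneg _

theorem sum_norm_plusKet_sq (θ : Angle) : ∑ b, ‖plusKet θ b‖ ^ 2 = 1 := by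
  have h := sum_star_plusKet_mul θ false false
  simp only [flipAngle, Complex.star_def, Complex.conj_mul'] at h
  simp only [Bool.false_eq_true, if_false, add_zero, if_true] at h
  exact_mod_cast h

/-- Cauchy–Schwarz for the Hilbert–Schmidt product of `A` with the unit-norm projection onto
`|+_θ⟩`, followed by the comparison with the trace norm. -/
theorem norm_overlap_le_traceNorm (θ : Angle) (A : Matrix Bool Bool ℂ) :
    ‖overlap θ A‖ ≤ traceNorm A := by
  refine le_of_sq_le_sq ?_ (traceNorm_nonneg A)
  refine le_trans ?_ (sum_normSq_le_traceNorm_sq A)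
  have h1 : ‖overlap θ A‖ ≤ ∑ p : Bool × Bool, ‖A p.1 p.2‖ * (‖plusKet θ p.1‖ * ‖plusKet θ p.2‖) := by
    rw [overlap_eq_sum, Fintype.sum_prod_type]
    refine (norm_sum_le _ _).trans (Finset.sum_le_sum fun a _ => ?_)
    refine (norm_sum_le _ _).trans (Finset.sum_le_sum fun b _ => ?_)
    rw [norm_mul, norm_mul, norm_star]
    apply le_of_eq
    ring
  calc ‖overlap θ A‖ ^ 2
      ≤ (∑ p : Bool × Bool, ‖A p.1 p.2‖ * (‖plusKet θ p.1‖ * ‖plusKet θ p.2‖)) ^ 2 :=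
        pow_le_pow_left₀ (norm_nonneg _) h1 2
    _ ≤ (∑ p : Bool × Bool, ‖A p.1 p.2‖ ^ 2) *
        ∑ p : Bool × Bool, (‖plusKet θ p.1‖ * ‖plusKet θ p.2‖) ^ 2 :=
        Finset.sum_mul_sq_le_sq_mul_sq _ _ _
    _ = _ := by
      have : ∑ p : Bool × Bool, (‖plusKet θ p.1‖ * ‖plusKet θ p.2‖) ^ 2 = 1 := by
        simp only [mul_pow, Fintype.sum_prod_type, ← Finset.mul_sum, sum_norm_plusKet_sq, mul_one]
      rw [this, mul_one, Fintype.sum_prod_type]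

theorem overlap_plusState (θ : Angle) : overlap θ (plusState θ) = 1 := by
  have h := sum_star_plusKet_mul θ false false
  simp only [flipAngle, Bool.false_eq_true, if_false, add_zero, if_true] at h
  have h2 : star (plusKet θ) ⬝ᵥ plusKet θ = 1 := h
  rw [overlap, plusState, Matrix.vecMulVec_mulVec, h2]
  simp [h2]

/-- The factor 2 appears because the overlap of the difference is bounded by the full trace norm. It
is harmless, as only a bound tending to 1 with vanishing distance is needed. -/
theorem one_sub_traceDistance_le (θ : Angle) (ρ : Matrix Bool Bool ℂ) :
    1 - 2 * traceDistance ρ (plusState θ) ≤ (overlap θ ρ).re := by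
  have h := norm_overlap_le_traceNorm θ (ρ - plusState θ)
  have h2 : overlap θ (ρ - plusState θ) = overlap θ ρ - 1 := by
    rw [← overlap_plusState θ, overlap, overlap, overlap, Matrix.sub_mulVec, dotProduct_sub]
  rw [h2] at h
  have h3 := (abs_le.1 (Complex.abs_re_le_norm (overlap θ ρ - 1))).1
  rw [traceDistance]
  simp only [Complex.sub_re, Complex.one_re] at h3
  linarith

/-! ### The honest computation -/

variable {N : ℕ}

theorem parityCount_congr {D : Finset (Fin N)} {s s' : Fin N → Bool}
    (h : ∀ u ∈ D, s u = s' u) : parityCount D s = parityCount D s' :=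
  Finset.sum_congr rfl fun u hu => by rw [h u hu]

theorem Pattern.corrected_congr (G : Pattern N) (φ : Fin N → Angle) {s s' : Fin N → Bool}
    {v : Fin N} (h : ∀ u < v, s u = s' u) : G.corrected φ s v = G.corrected φ s' v := by
  rw [Pattern.corrected, Pattern.corrected,
    parityCount_congr fun u hu => h u (G.xDep_lt v u hu),
    parityCount_congr fun u hu => h u (G.zDep_lt v u hu)]

theorem Pattern.corrected_of_false (G : Pattern N) (φ : Fin N → Angle) {s : Fin N → Bool}
    {v : Fin N} (h : ∀ u < v, s u = false) : G.corrected φ s v = φ v := by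
  rw [G.corrected_congr φ (s' := fun _ => false) h]
  simp [Pattern.corrected, parityCount]

theorem star_prod_dotProduct_prod (f g : Fin N → Bool → ℂ) :
    (star fun b : Bits (Fin N) => ∏ v, f v (b v)) ⬝ᵥ (fun b => ∏ v, g v (b v))
      = ∏ v, ∑ b, star (f v b) * g v b := by
  rw [Finset.prod_univ_sum, Fintype.piFinset_univ]
  simp [dotProduct, Finset.prod_mul_distrib]

/-- Adaptivity does not destroy orthogonality. As long as two outcome strings agree on the earlier
qubits, the corrected angle of the next qubit is the same for both, so a nonzero inner product
forces agreement there too; well-founded induction then gives equality. -/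
theorem Pattern.star_measurementKet_dotProduct (G : Pattern N) (φ : Fin N → Angle)
    (s s' : Fin N → Bool) :
    star (measurementKet (G.corrected φ s) s) ⬝ᵥ measurementKet (G.corrected φ s') s'
      = if s = s' then 1 else 0 := by
  unfold measurementKet
  rw [star_prod_dotProduct_prod]
  split_ifs with h
  · subst h
    exact Finset.prod_eq_one fun v _ => by rw [sum_star_plusKet_mul, if_pos rfl]
  · by_contra hne
    apply h
    have h0 := Finset.prod_ne_zero_iff.1 hne
    funext v
    induction v using WellFoundedLT.induction with
    | ind v ih =>
      have := h0 v (Finset.mem_univ v)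
      rw [G.corrected_congr φ ih, sum_star_plusKet_mul] at this
      by_contra hv
      exact this (if_neg hv)

theorem Pattern.norm_czSign (G : Pattern N) (b : Bits (Fin N)) : ‖G.czSign b‖ = 1 := by
  rw [Pattern.czSign, norm_prod]
  refine Finset.prod_eq_one fun u _ => ?_
  rw [norm_prod]
  refine Finset.prod_eq_one fun v _ => ?_
  split_ifs <;> simp

theorem Pattern.norm_graphState (G : Pattern N) :
    ‖(WithLp.toLp 2 G.graphState : EuclideanSpace ℂ (Bits (Fin N)))‖ = 1 := by
  rw [EuclideanSpace.norm_eq, Real.sqrt_eq_one]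
  have h : ∀ b, ‖G.graphState b‖ ^ 2 = ∏ v : Fin N, ‖plusKet 0 (b v)‖ ^ 2 := fun b => by
    rw [Pattern.graphState, norm_mul, G.norm_czSign, one_mul, norm_prod, Finset.prod_pow]
  simp only [h]
  have := Finset.prod_univ_sum (fun _ : Fin N => Finset.univ) (fun _ b => ‖plusKet 0 b‖ ^ 2)
  rw [Fintype.piFinset_univ] at this
  rw [← this]
  exact Finset.prod_eq_one fun v _ => sum_norm_plusKet_sq 0

/-- Bessel's inequality for the orthonormal outcome vectors and the unit graph state. Equality holds
but is not needed: the ideal resource only has to be sub-normalised. -/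
theorem Pattern.sum_norm_measurementKet_le (G : Pattern N) (φ : Fin N → Angle) :
    ∑ s, ‖star (measurementKet (G.corrected φ s) s) ⬝ᵥ G.graphState‖ ^ 2 ≤ 1 := by
  have ho : Orthonormal ℂ fun s : Fin N → Bool =>
      (WithLp.toLp 2 (measurementKet (G.corrected φ s) s) : EuclideanSpace ℂ (Bits (Fin N))) := by
    rw [orthonormal_iff_ite]
    intro s s'
    rw [EuclideanSpace.inner_toLp_toLp, dotProduct_comm]
    exact G.star_measurementKet_dotProduct φ s s'
  have := ho.sum_inner_products_le (WithLp.toLp 2 G.graphState) (s := Finset.univ)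
  rw [G.norm_graphState, one_pow] at this
  simpa only [EuclideanSpace.inner_toLp_toLp, dotProduct_comm] using this

theorem Pattern.honestProb_nonneg (G : Pattern N) (φ : Fin N → Angle) (out : G.Outcome) :
    0 ≤ G.honestProb φ out :=
  Finset.sum_nonneg fun s _ => by split_ifs <;> positivity

theorem Pattern.sum_honestProb_le (G : Pattern N) (φ : Fin N → Angle) :
    ∑ out, G.honestProb φ out ≤ 1 := by
  refine le_trans (le_of_eq ?_) (G.sum_norm_measurementKet_le φ)
  unfold Pattern.honestProb
  rw [Finset.sum_comm]
  refine Finset.sum_congr rfl fun s _ => ?_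
  rw [Finset.sum_eq_single (fun v => s v.1)]
  · simp
  · intro out _ hne
    rw [if_neg]
    intro h
    exact hne (funext h)
  · simp

/-! ### Tensor products over the instances -/

section Tensor

variable {H K M : Type}

/-- The tensor product of a family of matrices. -/
def tens (A : Fin N → Matrix H K ℂ) : Matrix (Fin N → H) (Fin N → K) ℂ :=
  Matrix.of fun a b => ∏ v, A v (a v) (b v)

theorem tens_apply (A : Fin N → Matrix H K ℂ) (a : Fin N → H) (b : Fin N → K) :
    tens A a b = ∏ v, A v (a v) (b v) := rfl

theorem tens_mul [Fintype K] (A : Fin N → Matrix H K ℂ) (B : Fin N → Matrix K M ℂ) :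
    tens A * tens B = tens fun v => A v * B v := by
  ext a b
  simp only [Matrix.mul_apply, tens_apply]
  rw [Finset.prod_univ_sum, Fintype.piFinset_univ]
  simp only [Finset.prod_mul_distrib]

theorem tens_conjTranspose (A : Fin N → Matrix H K ℂ) : (tens A)ᴴ = tens fun v => (A v)ᴴ := by
  ext a b
  simp [tens_apply, Matrix.conjTranspose_apply]

theorem tens_one [DecidableEq H] : tens (fun _ : Fin N => (1 : Matrix H H ℂ)) = 1 := by
  ext a b
  simp only [tens_apply, Matrix.one_apply]
  rw [Finset.prod_ite_zero]
  simp [funext_iff]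

theorem trace_tens [Fintype H] (A : Fin N → Matrix H H ℂ) :
    (tens A).trace = ∏ v, (A v).trace := by
  simp only [Matrix.trace, Matrix.diag, tens_apply]
  rw [Finset.prod_univ_sum, Fintype.piFinset_univ]

/-- Multilinearity of the tensor product: choosing one summand in every factor and summing over all
choices is expanding a product of sums. -/
theorem sum_tens {ι : Fin N → Type} [∀ v, Fintype (ι v)] (A : ∀ v, ι v → Matrix H K ℂ) :
    ∑ i : ∀ v, ι v, tens (fun v => A v (i v)) = tens fun v => ∑ j, A v j := by
  ext a b
  simp only [Matrix.sum_apply, tens_apply]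
  rw [Finset.prod_univ_sum, Fintype.piFinset_univ]

theorem sum_tens_update {ι : Type} [Fintype ι] (A : Fin N → Matrix H K ℂ) (v : Fin N)
    (B : ι → Matrix H K ℂ) :
    ∑ i, tens (Function.update A v (B i)) = tens (Function.update A v (∑ i, B i)) := by
  ext a b
  have h (C : Matrix H K ℂ) : tens (Function.update A v C) a b
      = C (a v) (b v) * ∏ u ∈ Finset.univ \ {v}, A u (a u) (b u) := by
    rw [tens_apply, Finset.prod_eq_mul_prod_sdiff_singleton_of_mem (Finset.mem_univ v),
      Function.update_self]
    congr 1
    refine Finset.prod_congr rfl fun u hu => ?_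
    rw [Function.update_of_ne (by simpa using hu)]
  simp only [Matrix.sum_apply, h, Finset.sum_mul]

end Tensor

/-! ### Operator-sum families -/

/-- An instrument together with an operator-sum form. -/
structure Kraus (H K Y : Type) [Fintype H] [DecidableEq H] [Fintype K] [Fintype Y] where
  ι : Type
  fin : Fintype ι
  op : Y → ι → Matrix K H ℂ
  complete : ∑ y, ∑ i, (op y i)ᴴ * op y i = 1

attribute [instance] Kraus.fin

def Kraus.toInstrument {H K Y : Type} [Fintype H] [DecidableEq H] [Fintype K] [Fintype Y]
    (F : Kraus H K Y) : Instrument H K Y where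
  map y ρ := ∑ i, F.op y i * ρ * (F.op y i)ᴴ
  isInstrument := ⟨F.ι, F.fin, F.op, F.complete, fun _ _ => rfl⟩

theorem Kraus.map_apply {H K Y : Type} [Fintype H] [DecidableEq H] [Fintype K] [Fintype Y]
    (F : Kraus H K Y) (y : Y) (ρ : Matrix H H ℂ) :
    F.toInstrument.map y ρ = ∑ i, F.op y i * ρ * (F.op y i)ᴴ := rfl

theorem Instrument.map_zero {H K Y : Type} [Fintype H] [DecidableEq H] [Fintype K] [Fintype Y]
    (F : Instrument H K Y) (y : Y) : F.map y 0 = 0 := by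
  obtain ⟨ι, _, A, -, hA⟩ := F.isInstrument
  simp [hA]

/-! ### Memory split into blocks -/

/-- The wires of a block: the qubit to be measured and the memory of one server instance. -/
abbrev Block (q : ℕ) : Type := Unit ⊕ Fin q

/-- Number of qubits of `N` blocks. -/
abbrev blockQubits (N q : ℕ) : ℕ := Fintype.card (Fin N × Block q)

def wire (N q : ℕ) : Fin N × Block q ≃ Fin (blockQubits N q) := Fintype.equivFin _

/-- Basis states of the memory are families of basis states of the blocks. -/
def split (N q : ℕ) : Reg (blockQubits N q) ≃ (Fin N → Bits (Block q)) where
  toFun a v j := a (wire N q (v, j))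
  invFun b i := b ((wire N q).symm i).1 ((wire N q).symm i).2
  left_inv a := by funext i; simp
  right_inv b := by funext v j; simp

/-- The product operator on the memory. -/
def place {q : ℕ} (A : Fin N → Matrix (Bits (Block q)) (Bits (Block q)) ℂ) :
    Matrix (Reg (blockQubits N q)) (Reg (blockQubits N q)) ℂ :=
  (tens A).submatrix (split N q) (split N q)

section Place

variable {q : ℕ} (A B : Fin N → Matrix (Bits (Block q)) (Bits (Block q)) ℂ)

theorem place_apply (a b : Reg (blockQubits N q)) :
    place A a b = ∏ v, A v (split N q a v) (split N q b v) := rfl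

theorem place_mul : place A * place B = place fun v => A v * B v := by
  rw [place, place, Matrix.submatrix_mul_equiv, tens_mul, place]

theorem place_conjTranspose : (place A)ᴴ = place fun v => (A v)ᴴ := by
  rw [place, Matrix.conjTranspose_submatrix, tens_conjTranspose, place]

theorem place_one : place (fun _ : Fin N => (1 : Matrix (Bits (Block q)) (Bits (Block q)) ℂ)) = 1 := by
  rw [place, tens_one, Matrix.submatrix_one_equiv]

theorem trace_place : (place A).trace = ∏ v, (A v).trace := by
  rw [place, ← trace_tens]
  exact (split N q).sum_comp fun a => tens A a a

theorem sum_place {ι : Fin N → Type} [∀ v, Fintype (ι v)]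
    (A : ∀ v, ι v → Matrix (Bits (Block q)) (Bits (Block q)) ℂ) :
    ∑ i : ∀ v, ι v, place (fun v => A v (i v)) = place fun v => ∑ j, A v j := by
  rw [place, ← sum_tens]
  ext a b
  simp [place, Matrix.sum_apply]

theorem sum_place_update {ι : Type} [Fintype ι] (v : Fin N)
    (B : ι → Matrix (Bits (Block q)) (Bits (Block q)) ℂ) :
    ∑ i, place (Function.update A v (B i)) = place (Function.update A v (∑ i, B i)) := by
  rw [place, ← sum_tens_update]
  ext a b
  simp [place, Matrix.sum_apply]

theorem zeroState_eq_place :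
    zeroState (blockQubits N q) = place fun _ => Matrix.of fun a b =>
      if a = (fun _ => false) ∧ b = (fun _ => false) then 1 else 0 := by
  have h (a : Reg (blockQubits N q)) :
      a = (fun _ => false) ↔ ∀ v, split N q a v = fun _ => false := by
    rw [← (split N q).injective.eq_iff, funext_iff]
    rfl
  ext a b
  simp only [place_apply, Matrix.of_apply, Finset.prod_ite_zero, Finset.prod_const_one, zeroState,
    Finset.mem_univ, true_implies, h, forall_and]

end Place

/-- The families on the blocks, applied in parallel. -/
def parallelKraus {q : ℕ} {α : Type} [Fintype α] [DecidableEq α]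
    (F : Fin N → Kraus (Bits (Block q)) (Bits (Block q)) (Bits α)) :
    Kraus (Reg (blockQubits N q)) (Reg (blockQubits N q)) (Bits (Fin N × α)) where
  ι := ∀ v, (F v).ι
  fin := inferInstance
  op y i := place fun v => (F v).op (fun j => y (v, j)) (i v)
  complete := by
    simp only [place_conjTranspose, place_mul]
    have h1 (y : Bits (Fin N × α)) := sum_place fun v j =>
      ((F v).op (fun k => y (v, k)) j)ᴴ * (F v).op (fun k => y (v, k)) j
    simp only [h1]
    -- Operator indices and outcomes both factor over the blocks, so `sum_place` is used once for
    -- each; the completeness relations of the single blocks then finish.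
    rw [← (Equiv.curry (Fin N) α Bool).symm.sum_comp]
    have h2 := sum_place fun v (y : Bits α) => ∑ j, ((F v).op y j)ᴴ * (F v).op y j
    refine Eq.trans h2 ?_
    simp only [(F _).complete, place_one]

theorem parallelKraus_map {q : ℕ} {α : Type} [Fintype α] [DecidableEq α]
    (F : Fin N → Kraus (Bits (Block q)) (Bits (Block q)) (Bits α)) (y : Bits (Fin N × α))
    (R : Fin N → Matrix (Bits (Block q)) (Bits (Block q)) ℂ) :
    (parallelKraus F).toInstrument.map y (place R)
      = place fun v => (F v).toInstrument.map (fun j => y (v, j)) (R v) := by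
  simp only [Kraus.map_apply]
  rw [← sum_place]
  refine Finset.sum_congr rfl fun i _ => ?_
  simp only [parallelKraus, place_conjTranspose, place_mul]

/-- A family acting on the block `v`. -/
def localKraus {q : ℕ} {Y : Type} [Fintype Y] (v : Fin N)
    (F : Kraus (Bits (Block q)) (Bits (Block q)) Y) :
    Kraus (Reg (blockQubits N q)) (Reg (blockQubits N q)) Y where
  ι := F.ι
  fin := F.fin
  op y i := place (Function.update 1 v (F.op y i))
  complete := by
    have h (A : Matrix (Bits (Block q)) (Bits (Block q)) ℂ) :
        (place (Function.update (1 : Fin N → _) v A))ᴴ * place (Function.update 1 v A)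
          = place (Function.update 1 v (Aᴴ * A)) := by
      rw [place_conjTranspose, place_mul]
      congr 1
      funext u
      rcases eq_or_ne u v with rfl | hu
      · simp
      · simp [Function.update_of_ne hu]
    simp only [h, sum_place_update, F.complete]
    rw [← place_one]
    congr 1
    exact Function.update_eq_self v 1

theorem localKraus_map {q : ℕ} {Y : Type} [Fintype Y] (v : Fin N)
    (F : Kraus (Bits (Block q)) (Bits (Block q)) Y) (y : Y)
    (R : Fin N → Matrix (Bits (Block q)) (Bits (Block q)) ℂ) :
    (localKraus v F).toInstrument.map y (place R)
      = place (Function.update R v (F.toInstrument.map y (R v))) := by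
  simp only [Kraus.map_apply]
  rw [← sum_place_update]
  refine Finset.sum_congr rfl fun i _ => ?_
  simp only [localKraus, place_conjTranspose, place_mul]
  congr 1
  funext u
  rcases eq_or_ne u v with rfl | hu
  · simp
  · simp [Function.update_of_ne hu]

theorem foldl_place {q L : ℕ} (R : Fin N → Matrix (Bits (Block q)) (Bits (Block q)) ℂ)
    (F : Fin L → Matrix (Reg (blockQubits N q)) (Reg (blockQubits N q)) ℂ →
      Matrix (Reg (blockQubits N q)) (Reg (blockQubits N q)) ℂ)
    (f : Fin L → Fin N → Matrix (Bits (Block q)) (Bits (Block q)) ℂ →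
      Matrix (Bits (Block q)) (Bits (Block q)) ℂ)
    (h : ∀ t R, F t (place R) = place fun v => f t v (R v)) :
    Fin.foldl L (fun ρ t => F t ρ) (place R)
      = place fun v => Fin.foldl L (fun ρ t => f t v ρ) (R v) := by
  induction L generalizing R with
  | zero => simp
  | succ L ih =>
    simp only [Fin.foldl_succ, h]
    exact ih _ (fun t => F t.succ) (fun t => f t.succ) fun t => h t.succ

theorem foldl_place_update {q : ℕ} (R : Fin N → Matrix (Bits (Block q)) (Bits (Block q)) ℂ)
    (F : Fin N → Matrix (Reg (blockQubits N q)) (Reg (blockQubits N q)) ℂ →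
      Matrix (Reg (blockQubits N q)) (Reg (blockQubits N q)) ℂ)
    (f : Fin N → Matrix (Bits (Block q)) (Bits (Block q)) ℂ →
      Matrix (Bits (Block q)) (Bits (Block q)) ℂ)
    (h : ∀ v R, F v (place R) = place (Function.update R v (f v (R v)))) :
    Fin.foldl N (fun ρ v => F v ρ) (place R) = place fun v => f v (R v) := by
  -- The induction needs the intermediate state, in which only the blocks in `l` have been
  -- processed. Absence of duplicates ensures that `f v` meets the original `R v`.
  have key : ∀ (l : List (Fin N)) (R : Fin N → Matrix (Bits (Block q)) (Bits (Block q)) ℂ),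
      l.Nodup → l.foldl (fun ρ v => F v ρ) (place R)
        = place fun v => if v ∈ l then f v (R v) else R v := by
    intro l
    induction l with
    | nil => intro R _; simp
    | cons u l ih =>
      intro R hl
      rw [List.foldl_cons, h, ih _ (List.nodup_cons.1 hl).2]
      congr 1
      funext v
      rcases eq_or_ne v u with rfl | hv
      · simp [(List.nodup_cons.1 hl).1]
      · simp [hv]
  rw [Fin.foldl_eq_foldl_finRange, key _ _ (List.nodup_finRange N)]
  simp

/-! ### The attack -/

/-- The state of a block in which the qubit to be measured is still `|0⟩`. -/
def lift {q : ℕ} (ρ : Matrix (Reg q) (Reg q) ℂ) : Matrix (Bits (Block q)) (Bits (Block q)) ℂ :=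
  Matrix.of fun a b => if a (.inl ()) = false ∧ b (.inl ()) = false then
    ρ (fun j => a (.inr j)) (fun j => b (.inr j)) else 0

theorem lift_zeroState (q : ℕ) :
    lift (zeroState q) = Matrix.of fun a b : Bits (Block q) =>
      if a = (fun _ => false) ∧ b = (fun _ => false) then (1 : ℂ) else 0 := by
  ext a b
  simp only [lift, zeroState, Matrix.of_apply, ← ite_and]
  congr 1
  simp only [funext_iff, Sum.forall]
  apply propext
  constructor
  · rintro ⟨⟨h1, h2⟩, h3, h4⟩
    exact ⟨⟨fun _ => h1, h3⟩, fun _ => h2, h4⟩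
  · rintro ⟨⟨h1, h3⟩, h2, h4⟩
    exact ⟨⟨h1 (), h2 ()⟩, h3, h4⟩

/-- Projection onto the block states of which the measured qubit has the value `b`. -/
def checkKraus (q : ℕ) (b : Bool) : Kraus (Bits (Block q)) (Bits (Block q)) Bool where
  ι := Unit
  fin := inferInstance
  op g _ := Matrix.diagonal fun a => if g = (a (.inl ()) == b) then 1 else 0
  complete := by
    simp only [Matrix.diagonal_conjTranspose, Matrix.diagonal_mul_diagonal, Fintype.sum_bool,
      Finset.univ_unique, Finset.sum_singleton, Matrix.diagonal_add]
    rw [← Matrix.diagonal_one]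
    congr 1
    funext a
    simp only [Pi.star_apply]
    cases h : (a (.inl ()) == b) <;> simp

/-- The probability that the measured qubit of the block has the value `b`. -/
def readProb {q : ℕ} (b : Bool) (R : Matrix (Bits (Block q)) (Bits (Block q)) ℂ) : ℂ :=
  ∑ a, if a (.inl ()) = b then R a a else 0

theorem sum_readProb {q : ℕ} (R : Matrix (Bits (Block q)) (Bits (Block q)) ℂ) :
    ∑ b, readProb b R = R.trace := by
  unfold readProb
  rw [Finset.sum_comm]
  simp [Matrix.trace]

theorem trace_checkKraus {q : ℕ} (b : Bool) (R : Matrix (Bits (Block q)) (Bits (Block q)) ℂ) :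
    ((checkKraus q b).toInstrument.map true R).trace = readProb b R := by
  change (∑ i : Unit, Matrix.diagonal _ * R * (Matrix.diagonal _)ᴴ).trace = _
  simp only [Finset.univ_unique, Finset.sum_singleton, Matrix.diagonal_conjTranspose,
    Matrix.trace, Matrix.diag, Matrix.mul_diagonal, Matrix.diagonal_mul, readProb]
  refine Finset.sum_congr rfl fun a _ => ?_
  by_cases h : a (.inl ()) = b <;> simp [h]

/-- The families used by the attack: `step` runs a preparation round of one server instance, and
`angle` produces its qubit and measures it. -/
structure Blocks (N L m q : ℕ) where
  step : Fin L → Bits (Fin m) → Kraus (Bits (Block q)) (Bits (Block q)) (Bits (Fin m))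
  angle : Fin N → Angle → Kraus (Bits (Block q)) (Bits (Block q)) Bool

/-- The probability that the server `v` measures `b` and answers `s`. Only the outcomes of the
qubits before `w` are announced. -/
def attackProb (φ : Fin N → Angle) (w v : Fin N) (τ : Matrix Bool Bool ℂ) (δ : Angle) (s b : Bool) :
    ℂ :=
  if s = (decide (v < w) && b) then overlap (δ - φ v + flipAngle b) τ else 0

/-- The blocks run the server `B`, and measure its qubit in the basis `|±_{δ - φ v}⟩`. -/
structure Blocks.Realizes {L m : ℕ} (B : RSPServer L m) (S : Blocks N L m B.qubits)
    (φ : Fin N → Angle) (w : Fin N) : Prop where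
  step : ∀ t x y ρ, (S.step t x).toInstrument.map y (lift ρ) = lift ((B.respond t x).map y ρ)
  angle : ∀ v δ s b ρ, readProb b ((S.angle v δ).toInstrument.map s (lift ρ))
    = attackProb φ w v (B.output.map () ρ) δ s b

/-- The distinguisher that inputs `φ` and runs the blocks. It finally checks whether the output bit
`w` equals the value measured on the qubit `w`. -/
def Blocks.distinguisher {L m q : ℕ} (S : Blocks N L m q) (G : Pattern N) (φ : Fin N → Angle)
    (w : {v : Fin N // v ∈ G.outputs}) : Distinguisher G ⟨L, m, N⟩ where
  qubits := blockQubits N q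
  choose := Kraus.toInstrument
    { ι := Unit
      fin := inferInstance
      op := fun φ' _ => if φ' = φ then 1 else 0
      complete := by
        have h (φ' : Fin N → Angle) :
            (if φ' = φ then (1 : Matrix (Reg (blockQubits N q)) (Reg (blockQubits N q)) ℂ) else 0)ᴴ
              * (if φ' = φ then 1 else 0) = if φ' = φ then 1 else 0 := by
          split_ifs <;> simp
        simp [h] }
  respond t x := (parallelKraus fun v => S.step t fun j => x (v, j)).toInstrument
  respondAngle v δ := (localKraus v (S.angle v δ)).toInstrument
  guess out := (localKraus w.1 (checkKraus q (out w))).toInstrument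

/-- The state of a distinguisher before its guess. -/
def Distinguisher.state {G : Pattern N} {I : ServerInterface} (D : Distinguisher G I)
    (φ : Fin N → Angle) (x y : Fin I.rounds → Msg N I) (δ : Fin I.angles → Angle)
    (s : Fin I.angles → Bool) : Matrix (Reg D.qubits) (Reg D.qubits) ℂ :=
  Fin.foldl I.angles (fun ρ v => (D.respondAngle v (δ v)).map (s v) ρ)
    (Fin.foldl I.rounds (fun ρ t => (D.respond t (x t)).map (y t) ρ)
      (D.choose.map φ (zeroState D.qubits)))

theorem foldl_eq_zero {H : Type} {L : ℕ} (f : Matrix H H ℂ → Fin L → Matrix H H ℂ)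
    (hf : ∀ t, f 0 t = 0) : Fin.foldl L f 0 = 0 := by
  induction L with
  | zero => simp
  | succ L ih =>
    rw [Fin.foldl_succ, hf]
    exact ih _ fun t => hf t.succ

section Weight

variable {L m : ℕ} {B : RSPServer L m} {S : Blocks N L m B.qubits} {φ : Fin N → Angle}
  {G : Pattern N} {w : {v : Fin N // v ∈ G.outputs}}

/-- `choose` is deterministic, so every other choice of angles starts from the zero operator, and
the linear rounds keep it zero. -/
theorem Blocks.state_of_ne {φ' : Fin N → Angle} (h : φ' ≠ φ) (x y : Fin L → Msg N ⟨L, m, N⟩)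
    (δ : Fin N → Angle) (s : Fin N → Bool) :
    (S.distinguisher G φ w).state φ' x y δ s = 0 := by
  have h0 : (S.distinguisher G φ w).choose.map φ' (zeroState _) = 0 := by
    simp [Blocks.distinguisher, Kraus.map_apply, h]
    rfl
  rw [Distinguisher.state, h0, foldl_eq_zero _ fun t => Instrument.map_zero _ _]
  exact foldl_eq_zero _ fun t => Instrument.map_zero _ _

/-- Each preparation round acts on the blocks in parallel and each angle round touches one block, so
for a fixed transcript the state stays a product. The measured wire stays in `|0⟩` until the angle
of its block arrives, so `Realizes` only has to describe lifted states. -/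
theorem Blocks.state_self (hS : S.Realizes B φ w) (x y : Fin L → Msg N ⟨L, m, N⟩)
    (δ : Fin N → Angle) (s : Fin N → Bool) :
    (S.distinguisher G φ w).state φ x y δ s = place fun v =>
      (S.angle v (δ v)).toInstrument.map (s v) (lift (Fin.foldl L
        (fun ρ t => (B.respond t fun j => x t (v, j)).map (fun j => y t (v, j)) ρ)
        (zeroState B.qubits))) := by
  have h0 : (S.distinguisher G φ w).choose.map φ (zeroState _)
      = place fun _ => lift (zeroState B.qubits) := by
    have : (S.distinguisher G φ w).choose.map φ (zeroState _)
        = zeroState (blockQubits N B.qubits) := by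
      simp [Blocks.distinguisher, Kraus.map_apply]
    rw [this, zeroState_eq_place, lift_zeroState]
  have h1 (ρ : Matrix (Reg B.qubits) (Reg B.qubits) ℂ) (v : Fin N) :
      Fin.foldl L (fun ρ t => (S.step t fun j => x t (v, j)).toInstrument.map
        (fun j => y t (v, j)) ρ) (lift ρ)
      = lift (Fin.foldl L
          (fun ρ t => (B.respond t fun j => x t (v, j)).map (fun j => y t (v, j)) ρ) ρ) := by
    rw [Fin.foldl_eq_foldl_finRange, Fin.foldl_eq_foldl_finRange]
    generalize List.finRange L = l
    induction l generalizing ρ with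
    | nil => rfl
    | cons t l ih => rw [List.foldl_cons, List.foldl_cons, hS.step, ih]
  rw [Distinguisher.state, h0]
  have h2 := foldl_place (N := N) (fun _ => lift (zeroState B.qubits))
    (fun (t : Fin L) ρ => ((S.distinguisher G φ w).respond t (x t)).map (y t) ρ)
    (fun t v ρ => (S.step t fun j => x t (v, j)).toInstrument.map (fun j => y t (v, j)) ρ)
    (fun t R => parallelKraus_map _ _ _)
  simp only [h1] at h2
  refine Eq.trans (congrArg _ h2) ?_
  exact foldl_place_update _ _ (fun v => (S.angle v (δ v)).toInstrument.map (s v))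
    fun v R => localKraus_map _ _ _ _

theorem Blocks.trace_state (hS : S.Realizes B φ w) (x y : Fin L → Msg N ⟨L, m, N⟩)
    (δ : Fin N → Angle) (s : Fin N → Bool) :
    ((S.distinguisher G φ w).state φ x y δ s).trace = ∏ v, ∑ b, attackProb φ w v
      (B.qubit (fun t i => x t (v, i)) (fun t i => y t (v, i))) (δ v) (s v) b := by
  rw [Blocks.state_self hS]
  refine (trace_place _).trans (Finset.prod_congr rfl fun v _ => ?_)
  simp only [← sum_readProb, hS.angle]
  rfl

/-- The final check acts on block `w` alone. Compared with `trace_state`, it replaces the sum over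
the hidden result at `w` by the single term prescribed by the output bit. -/
theorem Blocks.weight_self (hS : S.Realizes B φ w) (x y : Fin L → Msg N ⟨L, m, N⟩)
    (δ : Fin N → Angle) (s : Fin N → Bool) (out : G.Outcome) :
    (S.distinguisher G φ w).weight φ x y δ s out true
      = (attackProb φ w w (B.qubit (fun t i => x t (w, i)) (fun t i => y t (w, i))) (δ w) (s w)
          (out w) *
        ∏ v ∈ Finset.univ.erase w.1, ∑ b, attackProb φ w v
          (B.qubit (fun t i => x t (v, i)) (fun t i => y t (v, i))) (δ v) (s v) b).re := by
  change (((S.distinguisher G φ w).guess out).map true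
    ((S.distinguisher G φ w).state φ x y δ s)).trace.re = _
  rw [Blocks.state_self hS]
  change ((localKraus w.1 (checkKraus B.qubits (out w))).toInstrument.map true _).trace.re = _
  rw [localKraus_map, trace_place, ← Finset.mul_prod_erase _ _ (Finset.mem_univ w.1)]
  simp only [Function.update_self, trace_checkKraus, hS.angle]
  congr 2
  refine Finset.prod_congr rfl fun v hv => ?_
  rw [Function.update_of_ne (Finset.ne_of_mem_erase hv), ← sum_readProb]
  simp only [hS.angle]
  rfl

theorem Blocks.weight_of_ne {φ' : Fin N → Angle} (h : φ' ≠ φ) (x y : Fin L → Msg N ⟨L, m, N⟩)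
    (δ : Fin N → Angle) (s : Fin N → Bool) (out : G.Outcome) (b : Bool) :
    (S.distinguisher G φ w).weight φ' x y δ s out b = 0 := by
  change (((S.distinguisher G φ w).guess out).map b
    ((S.distinguisher G φ w).state φ' x y δ s)).trace.re = _
  rw [Blocks.state_of_ne h, Instrument.map_zero]
  simp

end Weight

/-! ### Probabilities of the attack -/

theorem RSPServer.posSemidef_qubit {L m : ℕ} (B : RSPServer L m) (x y : Fin L → Bits (Fin m)) :
    (B.qubit x y).PosSemidef :=
  Instrument.posSemidef _ _ (posSemidef_foldl _ (fun _ _ h => Instrument.posSemidef _ _ h)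
    (posSemidef_zeroState _))

theorem RSPClient.weight_nonneg {L m : ℕ} (A : RSPClient L m) (x y : Fin L → Bits (Fin m))
    (θ : Angle) : 0 ≤ A.weight x y θ :=
  posSemidef_re_trace_nonneg (Instrument.posSemidef _ _ (posSemidef_foldl _
    (fun _ _ h => Instrument.posSemidef _ _ (Instrument.posSemidef _ _ h))
    (posSemidef_zeroState _)))

theorem attackProb_nonneg (φ : Fin N → Angle) (w v : Fin N) {τ : Matrix Bool Bool ℂ}
    (h : τ.PosSemidef) (δ : Angle) (s b : Bool) : 0 ≤ attackProb φ w v τ δ s b := by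
  rw [attackProb]
  split_ifs
  · exact overlap_nonneg _ h
  · exact le_rfl

theorem attackProb_re_nonneg (φ : Fin N → Angle) (w v : Fin N) {τ : Matrix Bool Bool ℂ}
    (h : τ.PosSemidef) (δ : Angle) (s b : Bool) : 0 ≤ (attackProb φ w v τ δ s b).re :=
  (Complex.le_def.1 (attackProb_nonneg φ w v h δ s b)).1

theorem ofReal_attackProb (φ : Fin N → Angle) (w v : Fin N) {τ : Matrix Bool Bool ℂ}
    (h : τ.PosSemidef) (δ : Angle) (s b : Bool) :
    ((attackProb φ w v τ δ s b).re : ℂ) = attackProb φ w v τ δ s b := by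
  apply Complex.ext
  · simp
  · simpa using (Complex.le_def.1 (attackProb_nonneg φ w v h δ s b)).2

section Weight

variable {L m : ℕ} {B : RSPServer L m} {S : Blocks N L m B.qubits} {φ : Fin N → Angle}
  {G : Pattern N} {w : {v : Fin N // v ∈ G.outputs}}

theorem Blocks.weight_self_re (hS : S.Realizes B φ w) (x y : Fin L → Msg N ⟨L, m, N⟩)
    (δ : Fin N → Angle) (s : Fin N → Bool) (out : G.Outcome) :
    (S.distinguisher G φ w).weight φ x y δ s out true
      = (attackProb φ w w (B.qubit (fun t i => x t (w, i)) (fun t i => y t (w, i))) (δ w) (s w)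
          (out w)).re *
        ∏ v ∈ Finset.univ.erase w.1, ∑ b, (attackProb φ w v
          (B.qubit (fun t i => x t (v, i)) (fun t i => y t (v, i))) (δ v) (s v) b).re := by
  rw [Blocks.weight_self hS]
  rw [← Complex.ofReal_re (_ * _)]
  push_cast
  simp only [ofReal_attackProb φ _ _ (B.posSemidef_qubit _ _)]

theorem Blocks.trace_state_re (hS : S.Realizes B φ w) (x y : Fin L → Msg N ⟨L, m, N⟩)
    (δ : Fin N → Angle) (s : Fin N → Bool) :
    ((S.distinguisher G φ w).state φ x y δ s).trace.re
      = (∑ b, (attackProb φ w w (B.qubit (fun t i => x t (w, i)) (fun t i => y t (w, i))) (δ w)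
          (s w) b).re) *
        ∏ v ∈ Finset.univ.erase w.1, ∑ b, (attackProb φ w v
          (B.qubit (fun t i => x t (v, i)) (fun t i => y t (v, i))) (δ v) (s v) b).re := by
  rw [Blocks.trace_state hS, Finset.mul_prod_erase Finset.univ (fun v => ∑ b, (attackProb φ w v
          (B.qubit (fun t i => x t (v, i)) (fun t i => y t (v, i))) (δ v) (s v) b).re)
          (Finset.mem_univ w.1)]
  rw [← Complex.ofReal_re (∏ _, _)]
  push_cast
  simp only [ofReal_attackProb φ _ _ (B.posSemidef_qubit _ _)]

theorem Blocks.weight_nonneg (hS : S.Realizes B φ w) (x y : Fin L → Msg N ⟨L, m, N⟩)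
    (δ : Fin N → Angle) (s : Fin N → Bool) (out : G.Outcome) :
    0 ≤ (S.distinguisher G φ w).weight φ x y δ s out true := by
  rw [Blocks.weight_self_re hS]
  exact mul_nonneg (attackProb_re_nonneg _ _ _ (B.posSemidef_qubit _ _) _ _ _)
    (Finset.prod_nonneg fun v _ => Finset.sum_nonneg fun b _ =>
      attackProb_re_nonneg _ _ _ (B.posSemidef_qubit _ _) _ _ _)

theorem Blocks.accept_eq (R : Resource G ⟨L, m, N⟩) :
    (S.distinguisher G φ w).accept R = ∑ x : Fin L → Msg N ⟨L, m, N⟩,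
      ∑ y : Fin L → Msg N ⟨L, m, N⟩, ∑ δ : Fin N → Angle, ∑ s : Fin N → Bool, ∑ out : G.Outcome,
        R φ x y δ s out * (S.distinguisher G φ w).weight φ x y δ s out true := by
  rw [Distinguisher.accept, Finset.sum_eq_single φ]
  · intro φ' _ h
    simp only [Blocks.weight_of_ne h, mul_zero, Finset.sum_const_zero]
  · intro h
    exact absurd (Finset.mem_univ _) h

end Weight

/-! ### The simulated resource -/

section Simulated

variable {G : Pattern N} {I : ServerInterface} (σ : Simulator G I)

/-- The memory before `decide`. The angles `φ` do not enter: they reach the output only through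
`idealOutput`. -/
def Simulator.state (x y : Fin I.rounds → Msg N I) (δ : Fin I.angles → Angle)
    (s : Fin I.angles → Bool) : Matrix (Reg σ.qubits) (Reg σ.qubits) ℂ :=
  Fin.foldl I.angles
    (fun ρ v => (σ.receiveBit v (s v)).map () ((σ.sendAngle v).map (δ v) ρ))
    (Fin.foldl I.rounds
      (fun ρ t => (σ.receive t (y t)).map () ((σ.send t).map (x t) ρ)) (zeroState σ.qubits))

theorem Simulator.posSemidef_state (x y : Fin I.rounds → Msg N I) (δ : Fin I.angles → Angle)
    (s : Fin I.angles → Bool) : (σ.state x y δ s).PosSemidef :=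
  posSemidef_foldl _ (fun _ _ h => Instrument.posSemidef _ _ (Instrument.posSemidef _ _ h))
    (posSemidef_foldl _ (fun _ _ h => Instrument.posSemidef _ _ (Instrument.posSemidef _ _ h))
      (posSemidef_zeroState _))

theorem idealOutput_nonneg {q : ℕ} (φ : Fin N → Angle) (c : ServerInput G q)
    {ρ : Matrix (Reg q) (Reg q) ℂ} (h : ρ.PosSemidef) (out : G.Outcome) :
    0 ≤ idealOutput G φ c ρ out := by
  cases c with
  | honest => exact mul_nonneg (posSemidef_re_trace_nonneg h) (G.honestProb_nonneg _ _)
  | deviate ξ => exact posSemidef_re_trace_nonneg (Instrument.posSemidef _ _ h)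

/-- Whether the simulator asks for the honest computation or for a deviation, the output bits are a
sub-distribution of total weight at most the trace of its memory. Apart from nonnegativity, this is
all that the impossibility uses about the ideal functionality. -/
theorem sum_idealOutput_le {q : ℕ} (φ : Fin N → Angle) (c : ServerInput G q)
    {ρ : Matrix (Reg q) (Reg q) ℂ} (h : ρ.PosSemidef) :
    ∑ out, idealOutput G φ c ρ out ≤ ρ.trace.re := by
  cases c with
  | honest =>
    simp only [idealOutput, ← Finset.mul_sum]
    exact mul_le_of_le_one_right (posSemidef_re_trace_nonneg h) (G.sum_honestProb_le φ)
  | deviate ξ =>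
    simp only [idealOutput]
    rw [← (ξ φ).sum_trace ρ, Complex.re_sum]

theorem simulated_nonneg (φ : Fin N → Angle) (x y : Fin I.rounds → Msg N I)
    (δ : Fin I.angles → Angle) (s : Fin I.angles → Bool) (out : G.Outcome) :
    0 ≤ simulated G σ φ x y δ s out :=
  Finset.sum_nonneg fun _ _ =>
    idealOutput_nonneg _ _ (Instrument.posSemidef _ _ (σ.posSemidef_state x y δ s)) _

theorem sum_simulated_le (φ : Fin N → Angle) (x y : Fin I.rounds → Msg N I)
    (δ : Fin I.angles → Angle) (s : Fin I.angles → Bool) :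
    ∑ out, simulated G σ φ x y δ s out ≤ (σ.state x y δ s).trace.re := by
  change ∑ out, ∑ z, idealOutput G φ (σ.command z) (σ.decide.map z (σ.state x y δ s)) out ≤ _
  rw [Finset.sum_comm, ← σ.decide.sum_trace, Complex.re_sum]
  exact Finset.sum_le_sum fun z _ =>
    sum_idealOutput_le _ _ (Instrument.posSemidef _ _ (σ.posSemidef_state x y δ s))

theorem Distinguisher.posSemidef_state (D : Distinguisher G I) (φ : Fin N → Angle)
    (x y : Fin I.rounds → Msg N I) (δ : Fin I.angles → Angle) (s : Fin I.angles → Bool) :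
    (D.state φ x y δ s).PosSemidef :=
  posSemidef_foldl _ (fun _ _ h => Instrument.posSemidef _ _ h)
    (posSemidef_foldl _ (fun _ _ h => Instrument.posSemidef _ _ h)
      (Instrument.posSemidef _ _ (posSemidef_zeroState _)))

/-- Two applications of the transcript lemma: the angle rounds sum to the traces after preparation,
and the preparation rounds then sum to the initial traces. -/
theorem sum_trace_state_mul_trace_state (D : Distinguisher G I) (φ : Fin N → Angle) :
    ∑ x, ∑ y, ∑ δ, ∑ s, (σ.state x y δ s).trace * (D.state φ x y δ s).trace
      = (D.choose.map φ (zeroState D.qubits)).trace := by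
  have h1 := fun (ρ : Matrix (Reg σ.qubits) (Reg σ.qubits) ℂ)
    (ρ' : Matrix (Reg D.qubits) (Reg D.qubits) ℂ) => sum_trace_mul_trace_foldl (L := I.angles)
    (fun v δ s ρ => (σ.receiveBit v s).map () ((σ.sendAngle v).map δ ρ))
    (fun v δ s ρ => (D.respondAngle v δ).map s ρ)
    (fun t ρ ρ' => sum_trace_mul_trace_round _ _ _ ρ ρ') ρ ρ'
  have h2 := sum_trace_mul_trace_foldl (L := I.rounds)
    (fun t x y ρ => (σ.receive t y).map () ((σ.send t).map x ρ))
    (fun t x y ρ => (D.respond t x).map y ρ)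
    (fun t ρ ρ' => sum_trace_mul_trace_round _ _ _ ρ ρ')
    (zeroState σ.qubits) (D.choose.map φ (zeroState D.qubits))
  rw [trace_zeroState, one_mul] at h2
  rw [← h2]
  exact Finset.sum_congr rfl fun x _ => Finset.sum_congr rfl fun y _ => h1 _ _

theorem sum_re_trace_state_mul_le_one (D : Distinguisher G I) (φ : Fin N → Angle) :
    ∑ x, ∑ y, ∑ δ, ∑ s, (σ.state x y δ s).trace.re * (D.state φ x y δ s).trace.re ≤ 1 := by
  have h := congrArg Complex.re (sum_trace_state_mul_trace_state σ D φ)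
  have e (x y : Fin I.rounds → Msg N I) (δ : Fin I.angles → Angle) (s : Fin I.angles → Bool) :
      ((σ.state x y δ s).trace * (D.state φ x y δ s).trace).re
        = (σ.state x y δ s).trace.re * (D.state φ x y δ s).trace.re := by
    rw [← posSemidef_ofReal_trace (σ.posSemidef_state x y δ s), Complex.re_ofReal_mul,
      Complex.ofReal_re]
  simp only [Complex.re_sum, e] at h
  rw [h]
  have h3 := congrArg Complex.re (D.choose.sum_trace (zeroState D.qubits))
  rw [trace_zeroState, Complex.re_sum, Complex.one_re] at h3
  rw [← h3]
  exact Finset.single_le_sum (f := fun φ => (D.choose.map φ (zeroState D.qubits)).trace.re)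
    (fun φ _ => posSemidef_re_trace_nonneg (Instrument.posSemidef _ _ (posSemidef_zeroState _)))
    (Finset.mem_univ φ)

end Simulated

/-! ### Guessing the hidden result at `w` in two unbiased bases. -/

/-- The computation angles of the two attacks: `π/2` or `0` on the qubit `w`, and `0` elsewhere. -/
def testAngles (c : Bool) (w v : Fin N) : Angle := if c = true ∧ v = w then 2 else 0

theorem attackProb_testAngles (c : Bool) {w v : Fin N} (h : v ≠ w) :
    attackProb (testAngles c w) w v = attackProb (testAngles false w) w v := by
  unfold attackProb testAngles
  simp [h]

/-- An announced 1 at `w` has probability zero. For an announced 0 the sum on the right is the whole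
trace of the qubit, whatever the basis, while the two terms on the left are overlaps with vectors
from bases a quarter turn apart. -/
theorem attackProb_add_le (w : Fin N) {τ : Matrix Bool Bool ℂ} (h : τ.PosSemidef) (δ : Angle)
    (s b c : Bool) :
    (attackProb (testAngles false w) w w τ δ s b).re
      + (attackProb (testAngles true w) w w τ δ s c).re
      ≤ 9 / 5 * ∑ b, (attackProb (testAngles false w) w w τ δ s b).re := by
  cases s with
  | true => simp [attackProb]
  | false =>
    simp only [attackProb, lt_self_iff_false, decide_false, Bool.false_and, if_true,
      ← Complex.re_sum, sum_overlap_flip]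
    simpa [testAngles] using overlap_add_overlap_le δ b c h

/-- The bound holds transcript by transcript: the output bit is uncorrelated with the qubit `w`
except through the transcript, so for each basis it does no better than always naming the likelier
result. Averaging over transcripts costs at most a factor 1. -/
theorem accept_simulated_add_le {L m : ℕ} {B : RSPServer L m} {G : Pattern N}
    {w : {v : Fin N // v ∈ G.outputs}} {S T : Blocks N L m B.qubits}
    (hS : S.Realizes B (testAngles false w.1) w) (hT : T.Realizes B (testAngles true w.1) w)
    (σ : Simulator G ⟨L, m, N⟩) :
    (S.distinguisher G (testAngles false w.1) w).accept (simulated G σ)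
      + (T.distinguisher G (testAngles true w.1) w).accept (simulated G σ) ≤ 9 / 5 := by
  -- The transcript weights of the attack with all angles zero normalise both attacks, since their
  -- weights coincide.
  have h := sum_re_trace_state_mul_le_one σ (S.distinguisher G (testAngles false w.1) w)
    (testAngles false w.1)
  refine le_trans ?_ (mul_le_of_le_one_right (by norm_num : (0 : ℝ) ≤ 9 / 5) h)
  rw [Blocks.accept_eq, Blocks.accept_eq]
  simp only [← Finset.sum_add_distrib, Finset.mul_sum]
  refine Finset.sum_le_sum fun x _ => Finset.sum_le_sum fun y _ => Finset.sum_le_sum fun δ _ =>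
    Finset.sum_le_sum fun s _ => ?_
  rw [Finset.sum_add_distrib, Blocks.trace_state_re hS]
  simp only [Blocks.weight_self_re hS, Blocks.weight_self_re hT]
  set p : Bool → G.Outcome → ℝ := fun c out => simulated G σ (testAngles c w.1) x y δ s out with hp
  set t := (σ.state x y δ s).trace.re with ht
  set τ : Fin N → Matrix Bool Bool ℂ :=
    fun v => B.qubit (fun t i => x t (v, i)) (fun t i => y t (v, i)) with hτ
  set e : Bool → Bool → ℝ :=
    fun c b => (attackProb (testAngles c w.1) w w (τ w) (δ w) (s w) b).re with he
  set C : ℝ := ∏ v ∈ Finset.univ.erase w.1, ∑ b,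
    (attackProb (testAngles false w.1) w v (τ v) (δ v) (s v) b).re with hC
  have hC' : ∏ v ∈ Finset.univ.erase w.1, ∑ b,
      (attackProb (testAngles true w.1) w v (τ v) (δ v) (s v) b).re = C :=
    Finset.prod_congr rfl fun v hv => by
      rw [attackProb_testAngles true (Finset.ne_of_mem_erase hv)]
  rw [hC']
  have hτ' : ∀ v, (τ v).PosSemidef := fun v => B.posSemidef_qubit _ _
  have hC0 : 0 ≤ C := Finset.prod_nonneg fun v _ => Finset.sum_nonneg fun b _ =>
    attackProb_re_nonneg _ _ _ (hτ' v) _ _ _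
  have ht0 : 0 ≤ t := posSemidef_re_trace_nonneg (σ.posSemidef_state x y δ s)
  -- The witness `b` is the most likely result in the basis `c`. It may depend on the transcript and
  -- on `c`, which is why the bound in two bases must allow independent guesses.
  have key : ∀ c, ∃ b, ∑ out, p c out * (e c (out w) * C) ≤ t * C * e c b := by
    intro c
    obtain ⟨b, -, hb⟩ := Finset.exists_max_image Finset.univ (e c) ⟨true, Finset.mem_univ _⟩
    refine ⟨b, ?_⟩
    have hb0 : 0 ≤ e c b := attackProb_re_nonneg _ _ _ (hτ' _) _ _ _
    calc ∑ out, p c out * (e c (out w) * C) ≤ ∑ out, p c out * (e c b * C) :=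
          Finset.sum_le_sum fun out _ => mul_le_mul_of_nonneg_left
            (mul_le_mul_of_nonneg_right (hb _ (Finset.mem_univ _)) hC0)
            (simulated_nonneg σ _ _ _ _ _ _)
      _ = (∑ out, p c out) * (e c b * C) := by rw [Finset.sum_mul]
      _ ≤ t * (e c b * C) := mul_le_mul_of_nonneg_right (sum_simulated_le σ _ _ _ _ _)
          (mul_nonneg hb0 hC0)
      _ = _ := by ring
  obtain ⟨b, hb⟩ := key false
  obtain ⟨c, hc⟩ := key true
  have hbc : e false b + e true c ≤ 9 / 5 * ∑ b, e false b := attackProb_add_le w.1 (hτ' _) _ _ b c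
  calc _ ≤ t * C * e false b + t * C * e true c := add_le_add hb hc
    _ = t * C * (e false b + e true c) := by ring
    _ ≤ t * C * (9 / 5 * ∑ b, e false b) :=
      mul_le_mul_of_nonneg_left hbc (mul_nonneg ht0 hC0)
    _ = _ := by ring

/-! ### The real resource -/

theorem prod_sum_univ {α : Type} [Fintype α] (f : Fin N → α → ℝ) :
    ∏ v, ∑ j, f v j = ∑ p : Fin N → α, ∏ v, f v (p v) := by
  rw [Finset.prod_univ_sum, Fintype.piFinset_univ]

/-- The messages of parallel instances are families of messages. -/
def messagesEquiv (N L m : ℕ) :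
    (Fin L → Bits (Fin N × Fin m)) ≃ (Fin N → Fin L → Bits (Fin m)) where
  toFun x v t i := x t (v, i)
  invFun x t j := x j.1 t j.2
  left_inv _ := rfl
  right_inv _ := rfl

/-- The instances are independent: regrouping messages by instance instead of by round turns the sum
of products into a product of equal sums. -/
theorem sum_messages_prod {L m : ℕ}
    (f : (Fin L → Bits (Fin m)) → (Fin L → Bits (Fin m)) → Angle → ℝ) :
    ∑ x : Fin L → Bits (Fin N × Fin m), ∑ y : Fin L → Bits (Fin N × Fin m), ∑ θ : Fin N → Angle,
      ∏ v, f (fun t i => x t (v, i)) (fun t i => y t (v, i)) (θ v)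
      = (∑ x, ∑ y, ∑ θ, f x y θ) ^ N := by
  have h : (∑ x, ∑ y, ∑ θ, f x y θ) ^ N = ∏ _v : Fin N, ∑ x, ∑ y, ∑ θ, f x y θ := by simp
  rw [h, prod_sum_univ, ← (messagesEquiv N L m).sum_comp]
  refine Finset.sum_congr rfl fun x _ => ?_
  rw [prod_sum_univ, ← (messagesEquiv N L m).sum_comp]
  refine Finset.sum_congr rfl fun y _ => ?_
  rw [prod_sum_univ]
  rfl

/-- The expected overlap of the qubit prepared by the protocol with the state `|+_θ⟩`. -/
def RSPProtocol.fidelity (P : RSPProtocol) : ℝ :=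
  ∑ x, ∑ y, ∑ θ, P.client.weight x y θ * (overlap θ (P.server.qubit x y)).re

/-- Runs close to the target contribute at least `1 - 2 * μ` times their probability to the expected
overlap; the remaining runs contribute nonnegatively. -/
theorem RSPProtocol.probClose_mul_le_fidelity (P : RSPProtocol) (μ : ℝ) :
    P.probClose μ * (1 - 2 * μ) ≤ P.fidelity := by
  rw [RSPProtocol.probClose, RSPProtocol.fidelity]
  simp only [Finset.sum_mul]
  refine Finset.sum_le_sum fun x _ => Finset.sum_le_sum fun y _ => Finset.sum_le_sum fun θ _ => ?_
  have hτ := P.server.posSemidef_qubit x y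
  set τ := P.server.qubit x y
  have hw := P.client.weight_nonneg x y θ
  have ho := overlap_re_nonneg θ hτ
  split_ifs with h
  · rw [mul_assoc]
    refine mul_le_mul_of_nonneg_left ?_ hw
    -- A transcript of zero trace has no normalised state (the inverse is 0 by convention), but it
    -- also contributes nothing to the left side.
    rcases eq_or_ne τ.trace 0 with h0 | h0
    · simpa [h0] using ho
    · have h1 := one_sub_traceDistance_le θ ((τ.trace)⁻¹ • τ)
      have h2 : τ.trace.re * (overlap θ ((τ.trace)⁻¹ • τ)).re = (overlap θ τ).re := by
        rw [← Complex.re_ofReal_mul, posSemidef_ofReal_trace hτ, overlap, Matrix.smul_mulVec,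
          dotProduct_smul, smul_eq_mul, mul_inv_cancel_left₀ h0, overlap]
      rw [← h2]
      exact mul_le_mul_of_nonneg_left (by linarith) (posSemidef_re_trace_nonneg hτ)
  · rw [zero_mul]
    exact mul_nonneg hw ho

/-- For every choice of the client's secrets `θ` and `r`, one accepting continuation is kept: the
one in which each qubit up to `w` is found in `|+_{θ_v}⟩`, i.e. with result `r_v`. Its weight is at
least the product of the overlaps, and this product factorises over the instances. -/
theorem fidelity_pow_le_accept_realResource {G : Pattern N} (P : RSPProtocol)
    {w : {v : Fin N // v ∈ G.outputs}} {S : Blocks N P.rounds P.len P.server.qubits}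
    {φ : Fin N → Angle} (hS : S.Realizes P.server φ w) :
    P.fidelity ^ N ≤ (S.distinguisher G φ w).accept (realResource G P) := by
  rw [Blocks.accept_eq, RSPProtocol.fidelity,
    ← sum_messages_prod fun x y θ => P.client.weight x y θ * (overlap θ (P.server.qubit x y)).re]
  refine Finset.sum_le_sum fun x _ => Finset.sum_le_sum fun y _ => ?_
  set τ : Fin N → Matrix Bool Bool ℂ :=
    fun v => P.server.qubit (fun t i => x t (v, i)) (fun t i => y t (v, i)) with hτ
  have hτ' : ∀ v, (τ v).PosSemidef := fun v => P.server.posSemidef_qubit _ _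
  set a : (Fin N → Angle) → ℝ := fun θ =>
    ∏ v, P.client.weight (fun t i => x t (v, i)) (fun t i => y t (v, i)) (θ v) with ha
  have ha0 : ∀ θ, 0 ≤ a θ := fun θ => Finset.prod_nonneg fun v _ => P.client.weight_nonneg _ _ _
  -- Nonnegative joint weight of the client's secrets `q` and of the rest `p` of the interaction;
  -- nonnegativity allows discarding all but one `p` for each `q`.
  let f : ((Fin N → Angle) × (Fin N → Bool)) → ((Fin N → Angle) × (Fin N → Bool) × G.Outcome) → ℝ :=
    fun q p => a q.1 * (1 / 2) ^ N *
      (if (∀ v, p.1 v = G.corrected φ (fun u => xor (p.2.1 u) (q.2 u)) v + q.1 v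
          + flipAngle (q.2 v)) ∧ (∀ v, p.2.2 v = xor (p.2.1 v.1) (q.2 v.1)) then 1 else 0) *
      (S.distinguisher G φ w).weight φ x y p.1 p.2.1 p.2.2 true
  have hf0 : ∀ q p, 0 ≤ f q p := fun q p => by
    refine mul_nonneg (mul_nonneg (mul_nonneg (ha0 _) (by positivity)) ?_)
      (Blocks.weight_nonneg hS _ _ _ _ _)
    split_ifs <;> norm_num
  have hsum : ∑ δ : Fin N → Angle, ∑ s : Fin N → Bool, ∑ out : G.Outcome,
      realResource G P φ x y δ s out * (S.distinguisher G φ w).weight φ x y δ s out true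
      = ∑ q : (Fin N → Angle) × (Fin N → Bool), ∑ p, f q p := by
    rw [Finset.sum_comm (f := f), Fintype.sum_prod_type]
    refine Finset.sum_congr rfl fun δ _ => ?_
    rw [Fintype.sum_prod_type]
    refine Finset.sum_congr rfl fun s _ => Finset.sum_congr rfl fun out _ => ?_
    rw [Fintype.sum_prod_type, realResource, Finset.sum_mul]
    refine Finset.sum_congr rfl fun θ _ => ?_
    rw [Finset.sum_mul]
  rw [hsum, Fintype.sum_prod_type]
  refine Finset.sum_le_sum fun θ _ => ?_
  have hterm : ∀ r : Fin N → Bool,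
      a θ * (1 / 2) ^ N * ∏ v, (overlap (θ v) (τ v)).re ≤ ∑ p, f (θ, r) p := by
    intro r
    -- The kept continuation: before `w` the server announces `r_v`, afterwards 0; the angles and
    -- the output are those the client then computes.
    let s : Fin N → Bool := fun v => decide (v < w.1) && r v
    let δ : Fin N → Angle := fun v =>
      G.corrected φ (fun u => xor (s u) (r u)) v + θ v + flipAngle (r v)
    let out : G.Outcome := fun v => xor (s v.1) (r v.1)
    refine le_trans ?_ (Finset.single_le_sum (fun p _ => hf0 (θ, r) p)
      (Finset.mem_univ (δ, s, out)))
    have hcond : f (θ, r) (δ, s, out)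
        = a θ * (1 / 2) ^ N * (S.distinguisher G φ w).weight φ x y δ s out true := by
      simp [f, δ, out]
    rw [hcond]
    refine mul_le_mul_of_nonneg_left ?_ (mul_nonneg (ha0 _) (by positivity))
    -- Announcing `r_u` makes the decoded outcome `s̄_u` vanish for all `u < w`, so neither
    -- dependency set changes an angle up to and including `w`.
    have hcorr : ∀ v ≤ w.1, G.corrected φ (fun u => xor (s u) (r u)) v = φ v := fun v hv =>
      G.corrected_of_false φ fun u hu => by simp [s, lt_of_lt_of_le hu hv]
    have hangle : ∀ v ≤ w.1, δ v - φ v + flipAngle (r v) = θ v := fun v hv => by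
      simp only [δ, hcorr v hv]
      rw [show φ v + θ v + flipAngle (r v) - φ v + flipAngle (r v)
        = θ v + (flipAngle (r v) + flipAngle (r v)) by ring, flipAngle_add_self, add_zero]
    have hsw : s w.1 = false := by simp [s]
    rw [Blocks.weight_self_re hS, ← Finset.mul_prod_erase _ _ (Finset.mem_univ w.1)]
    refine mul_le_mul ?_ (Finset.prod_le_prod (fun v _ => overlap_re_nonneg _ (hτ' v))
      fun v hv => ?_) (Finset.prod_nonneg fun v _ => overlap_re_nonneg _ (hτ' v))
      (attackProb_re_nonneg _ _ _ (hτ' _) _ _ _)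
    · have hout : out w = r w.1 := by simp [out, hsw]
      rw [attackProb, hsw, hout, hangle w.1 le_rfl, if_pos (by simp)]
    · rcases lt_or_gt_of_ne (Finset.ne_of_mem_erase hv) with hlt | hlt
      · refine le_trans (le_of_eq ?_) (Finset.single_le_sum
          (fun b _ => attackProb_re_nonneg _ _ _ (hτ' v) _ _ b) (Finset.mem_univ (r v)))
        have hsv : s v = r v := by simp [s, hlt]
        rw [attackProb, hsv, hangle v hlt.le, if_pos (by simp [hlt])]
      -- After `w` corrections may occur and the measured basis may be wrong, but nothing is checked
      -- there: the total over both results is the trace, which dominates the overlap.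
      · have hsv : s v = false := by simp [s, hlt.not_gt]
        have : ∀ b, attackProb φ w.1 v (τ v) (δ v) (s v) b
            = overlap (δ v - φ v + flipAngle b) (τ v) := fun b => by
          rw [attackProb, hsv, if_pos (by simp [hlt.not_gt])]
        change _ ≤ ∑ b, (attackProb φ w.1 v (τ v) (δ v) (s v) b).re
        simp only [this, ← Complex.re_sum, sum_overlap_flip]
        exact overlap_re_le_trace _ (hτ' v)
  calc ∏ v, P.client.weight (fun t i => x t (v, i)) (fun t i => y t (v, i)) (θ v)
          * (overlap (θ v) (τ v)).re
      -- The weight `(1/2)^N` of a single `r` is compensated by the `2^N` choices of `r`, each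
      -- giving the same lower bound.
      = ∑ _r : Fin N → Bool, a θ * (1 / 2) ^ N * ∏ v, (overlap (θ v) (τ v)).re := by
        rw [Finset.prod_mul_distrib, Finset.sum_const, Finset.card_univ, Fintype.card_fun,
          Fintype.card_bool, Fintype.card_fin, nsmul_eq_mul]
        push_cast
        have : (2 : ℝ) ^ N * (1 / 2) ^ N = 1 := by rw [← mul_pow]; norm_num
        linear_combination (-(a θ) * ∏ v, (overlap (θ v) (τ v)).re) * this
    _ ≤ _ := Finset.sum_le_sum fun r _ => hterm r

/-! ### Failure of indistinguishability -/

theorem Negligible.tendsto_zero {f : ℕ → ℝ} (h : Negligible f) :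
    Filter.Tendsto f Filter.atTop (nhds 0) := by
  simpa using h 0

/-- The two attacks cannot both have a negligible advantage. -/
theorem not_negligible_advantages {G : Pattern N} {P : ℕ → RSPProtocol} (hP : IsCorrectRSP P)
    (w : {v : Fin N // v ∈ G.outputs}) (σ : ∀ n, Simulator G ((P n).iface N))
    {S : Bool → ∀ n, Blocks N (P n).rounds (P n).len (P n).server.qubits}
    (hS : ∀ c n, (S c n).Realizes (P n).server (testAngles c w.1) w)
    (hneg : ∀ c, Negligible fun n => ((S c n).distinguisher G (testAngles c w.1) w).advantage
      (realResource G (P n)) (simulated G (σ n))) : False := by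
  obtain ⟨μ, ν, hμ, hν, hclose⟩ := hP
  -- This lower bound for the sum of the two advantages tends to 1/5, whereas the sum is assumed to
  -- tend to 0. It is valid once `μ n < 1/2` and `ν n < 1`, so that the base of the power is
  -- nonnegative.
  have hlim : Filter.Tendsto (fun n => 2 * ((1 - ν n) * (1 - 2 * μ n)) ^ N - 9 / 5) Filter.atTop
      (nhds (2 * ((1 - 0) * (1 - 2 * 0)) ^ N - 9 / 5)) :=
    ((((tendsto_const_nhds.sub hν.tendsto_zero).mul
      (tendsto_const_nhds.sub (hμ.tendsto_zero.const_mul 2))).pow N).const_mul 2).sub_const _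
  have hadv := (hneg false).tendsto_zero.add (hneg true).tendsto_zero
  have hμ' : ∀ᶠ n in Filter.atTop, μ n < 1 / 2 :=
    hμ.tendsto_zero.eventually_lt_const (by norm_num)
  have hν' : ∀ᶠ n in Filter.atTop, ν n < 1 := hν.tendsto_zero.eventually_lt_const (by norm_num)
  have hle := le_of_tendsto_of_tendsto hlim hadv (by
    filter_upwards [hμ', hν'] with n hμn hνn
    have h0 : 0 ≤ (1 - ν n) * (1 - 2 * μ n) := mul_nonneg (by linarith) (by linarith)
    have h1 : (1 - ν n) * (1 - 2 * μ n) ≤ (P n).fidelity :=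
      le_trans (mul_le_mul_of_nonneg_right (hclose n) (by linarith))
        ((P n).probClose_mul_le_fidelity _)
    have h2 := pow_le_pow_left₀ h0 h1 N
    have r0 := fidelity_pow_le_accept_realResource (P n) (hS false n)
    have r1 := fidelity_pow_le_accept_realResource (P n) (hS true n)
    have hi := accept_simulated_add_le (hS false n) (hS true n) (σ n)
    have a0 := le_abs_self
      (((S false n).distinguisher G (testAngles false w.1) w).accept (realResource G (P n))
      - ((S false n).distinguisher G (testAngles false w.1) w).accept (simulated G (σ n)))
    have a1 := le_abs_self
      (((S true n).distinguisher G (testAngles true w.1) w).accept (realResource G (P n))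
      - ((S true n).distinguisher G (testAngles true w.1) w).accept (simulated G (σ n)))
    simp only [Distinguisher.advantage]
    linarith)
  norm_num at hle

/-! ### Operators on a subset of the wires -/

section Embed

set_option linter.unusedSectionVars false

variable {V W : Type} [Fintype V] [DecidableEq V] [Fintype W] [DecidableEq W]

open Classical in
/-- The operator `A` applied to the wires in the range of `f`. -/
def embed (f : V → W) (A : Matrix (Bits V) (Bits V) ℂ) : Matrix (Bits W) (Bits W) ℂ :=
  Matrix.of fun a b => if ∀ w, w ∉ Set.range f → a w = b w then
    A (fun v => a (f v)) (fun v => b (f v)) else 0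

open Classical in
theorem embed_apply (f : V → W) (A : Matrix (Bits V) (Bits V) ℂ) (a b : Bits W) :
    embed f A a b = if ∀ w, w ∉ Set.range f → a w = b w then
      A (fun v => a (f v)) (fun v => b (f v)) else 0 := rfl

open Classical in
-- Strings that agree with `a` off the range of `f` are parametrised by their restriction to the
-- wires of `f`, with `Function.extend` as the inverse. This makes products with `embed` computable.
theorem sum_ite_eq_off_range {f : V → W} (hf : f.Injective) (a : Bits W) (g : Bits W → ℂ) :
    (∑ c, if ∀ w, w ∉ Set.range f → a w = c w then g c else 0)
      = ∑ c : Bits V, g (Function.extend f c a) := by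
  rw [← Finset.sum_filter]
  symm
  refine Finset.sum_nbij' (fun c => Function.extend f c a) (fun c v => c (f v)) ?_ ?_ ?_ ?_ ?_
  · intro c _
    simp only [Finset.mem_filter, Finset.mem_univ, true_and]
    intro w hw
    exact (Function.extend_apply' _ _ _ hw).symm
  · simp
  · intro c _
    funext v
    exact hf.extend_apply _ _ _
  · intro c hc
    simp only [Finset.mem_filter, Finset.mem_univ, true_and] at hc
    funext w
    by_cases hw : w ∈ Set.range f
    · obtain ⟨v, rfl⟩ := hw
      exact hf.extend_apply _ _ _
    · rw [Function.extend_apply' _ _ _ hw, hc w hw]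
  · simp

theorem embed_mul_apply {K : Type} {f : V → W} (hf : f.Injective) (A : Matrix (Bits V) (Bits V) ℂ)
    (X : Matrix (Bits W) K ℂ) (a : Bits W) (b : K) :
    (embed f A * X) a b = ∑ c : Bits V, A (fun v => a (f v)) c * X (Function.extend f c a) b := by
  classical
  have h := sum_ite_eq_off_range hf a fun c =>
    A (fun v => a (f v)) (fun v => c (f v)) * X c b
  simp only [hf.extend_apply] at h
  rw [← h, Matrix.mul_apply]
  refine Finset.sum_congr rfl fun c _ => ?_
  rw [embed_apply, ite_mul, zero_mul]

theorem embed_mul {f : V → W} (hf : f.Injective) (A B : Matrix (Bits V) (Bits V) ℂ) :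
    embed f A * embed f B = embed f (A * B) := by
  classical
  ext a b
  rw [embed_mul_apply hf]
  simp only [embed_apply, hf.extend_apply, Matrix.mul_apply]
  have h : ∀ c : Bits V, (∀ w, w ∉ Set.range f → Function.extend f c a w = b w)
      ↔ ∀ w, w ∉ Set.range f → a w = b w := fun c =>
    forall₂_congr fun w hw => by rw [Function.extend_apply' _ _ _ hw]
  simp only [h]
  split_ifs <;> simp

theorem embed_conjTranspose (f : V → W) (A : Matrix (Bits V) (Bits V) ℂ) :
    (embed f A)ᴴ = embed f Aᴴ := by
  classical
  ext a b
  rw [Matrix.conjTranspose_apply, embed_apply, embed_apply, apply_ite star, star_zero]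
  simp only [eq_comm, Matrix.conjTranspose_apply]

theorem embed_one (f : V → W) : embed f (1 : Matrix (Bits V) (Bits V) ℂ) = 1 := by
  classical
  ext a b
  rw [embed_apply, Matrix.one_apply, Matrix.one_apply, ← ite_and]
  congr 1
  apply propext
  constructor
  · rintro ⟨h1, h2⟩
    funext w
    by_cases hw : w ∈ Set.range f
    · obtain ⟨v, rfl⟩ := hw
      exact congrFun h2 v
    · exact h1 w hw
  · rintro rfl
    simp

theorem sum_embed {ι : Type} [Fintype ι] (f : V → W) (A : ι → Matrix (Bits V) (Bits V) ℂ) :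
    ∑ i, embed f (A i) = embed f (∑ i, A i) := by
  classical
  ext a b
  simp only [Matrix.sum_apply, embed_apply]
  split_ifs <;> simp

end Embed

theorem forall_notMem_range_inr {V W : Type} {p : V ⊕ W → Prop} :
    (∀ w, w ∉ Set.range (Sum.inr : W → V ⊕ W) → p w) ↔ ∀ v, p (.inl v) := by
  simp [Sum.forall]

theorem sum_bits_sum {α β : Type} [Fintype α] [DecidableEq α] [Fintype β] [DecidableEq β]
    (f : Bits (α ⊕ β) → ℂ) : ∑ c, f c = ∑ a : Bits α, ∑ b : Bits β, f (Sum.elim a b) := by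
  rw [← (Equiv.sumArrowEquivProdArrow α β Bool).symm.sum_comp, Fintype.sum_prod_type]
  rfl

theorem sum_bits_unit (f : Bits Unit → ℂ) : ∑ c, f c = ∑ b : Bool, f fun _ => b :=
  ((Equiv.funUnique Unit Bool).symm.sum_comp f).symm

/-! ### States of a block -/

theorem embed_inr_apply {q : ℕ} (A : Matrix (Reg q) (Reg q) ℂ) (a b : Bits (Block q)) :
    embed Sum.inr A a b = if a (.inl ()) = b (.inl ()) then
      A (fun j => a (.inr j)) (fun j => b (.inr j)) else 0 := by
  classical
  rw [embed_apply]
  refine if_congr ?_ rfl rfl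
  rw [forall_notMem_range_inr]
  exact ⟨fun h => h (), fun h _ => h⟩

theorem lift_eq {q : ℕ} (ρ : Matrix (Reg q) (Reg q) ℂ) :
    lift ρ = embed Sum.inr ρ * Matrix.diagonal fun a : Bits (Block q) =>
      if a (.inl ()) = false then 1 else 0 := by
  ext a b
  rw [Matrix.mul_diagonal, embed_inr_apply, lift, Matrix.of_apply]
  cases a (.inl ()) <;> cases b (.inl ()) <;> simp

theorem embed_inr_mul_diagonal {q : ℕ} (A : Matrix (Reg q) (Reg q) ℂ) :
    embed Sum.inr A * (Matrix.diagonal fun a : Bits (Block q) =>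
        if a (.inl ()) = false then (1 : ℂ) else 0)
      = (Matrix.diagonal fun a : Bits (Block q) => if a (.inl ()) = false then (1 : ℂ) else 0)
        * embed Sum.inr A := by
  ext a b
  rw [Matrix.mul_diagonal, Matrix.diagonal_mul, embed_inr_apply]
  cases a (.inl ()) <;> cases b (.inl ()) <;> simp

/-- `lift` multiplies an operator on the memory by the projection onto value 0 of the measured wire,
and operators on the memory commute with this projection. -/
theorem embed_mul_lift_mul {q : ℕ} (A ρ : Matrix (Reg q) (Reg q) ℂ) :
    embed Sum.inr A * lift ρ * (embed Sum.inr A)ᴴ = lift (A * ρ * Aᴴ) := by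
  have hinj : Function.Injective (Sum.inr : Fin q → Block q) := Sum.inr_injective
  rw [lift_eq, lift_eq, embed_conjTranspose, Matrix.mul_assoc, Matrix.mul_assoc,
    ← embed_inr_mul_diagonal, ← Matrix.mul_assoc, ← Matrix.mul_assoc, embed_mul hinj,
    embed_mul hinj]

theorem sum_lift {ι : Type} [Fintype ι] {q : ℕ} (ρ : ι → Matrix (Reg q) (Reg q) ℂ) :
    ∑ i, lift (ρ i) = lift (∑ i, ρ i) := by
  simp only [lift_eq, ← Finset.sum_mul, sum_embed]

/-- The basis change to `|±_α⟩`. -/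
def basisChange (α : Angle) : Matrix Bool Bool ℂ :=
  Matrix.of fun b d => star (plusKet (α + flipAngle b) d)

theorem basisChange_conjTranspose_mul (α : Angle) : (basisChange α)ᴴ * basisChange α = 1 := by
  ext a b
  rw [Matrix.mul_apply, Matrix.one_apply, ← sum_star_plusKet_flip_mul α a b]
  have h : star (∑ s, star (plusKet (α + flipAngle s) b) * plusKet (α + flipAngle s) a)
      = ∑ s, star (plusKet (α + flipAngle s) a) * plusKet (α + flipAngle s) b := by
    rw [star_sum]
    exact Finset.sum_congr rfl fun s _ => by rw [star_mul, star_star]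
  rw [← h, sum_star_plusKet_flip_mul]
  simp only [Matrix.conjTranspose_apply, basisChange, Matrix.of_apply, star_star]
  calc _ = ∑ s, star (plusKet (α + flipAngle s) b) * plusKet (α + flipAngle s) a :=
        Finset.sum_congr rfl fun s _ => mul_comm _ _
    _ = _ := by rw [sum_star_plusKet_flip_mul]; split_ifs <;> simp

theorem overlap_eq_basisChange (α : Angle) (b : Bool) (τ : Matrix Bool Bool ℂ) :
    overlap (α + flipAngle b) τ = (basisChange α * τ * (basisChange α)ᴴ) b b := by
  rw [overlap_eq_sum]
  simp only [Matrix.mul_apply, Finset.sum_mul, Matrix.conjTranspose_apply, basisChange,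
    Matrix.of_apply, star_star]
  rw [Finset.sum_comm]

/-! ### Blocks from operator-sum forms -/

theorem Instrument.exists_kraus {H K Y : Type} [Fintype H] [DecidableEq H] [Fintype K] [Fintype Y]
    (F : Instrument H K Y) : ∃ A : Kraus H K Y, ∀ y ρ, A.toInstrument.map y ρ = F.map y ρ := by
  obtain ⟨ι, h, A, h1, hA⟩ := F.isInstrument
  exact ⟨⟨ι, h, A, h1⟩, fun y ρ => (hA y ρ).symm⟩

def Instrument.kraus {H K Y : Type} [Fintype H] [DecidableEq H] [Fintype K] [Fintype Y]
    (F : Instrument H K Y) : Kraus H K Y := F.exists_kraus.choose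

theorem Instrument.kraus_map {H K Y : Type} [Fintype H] [DecidableEq H] [Fintype K] [Fintype Y]
    (F : Instrument H K Y) (y : Y) (ρ : Matrix H H ℂ) :
    F.kraus.toInstrument.map y ρ = F.map y ρ := F.exists_kraus.choose_spec y ρ

/-- A family applied to the server memory of a block. -/
def memoryKraus {q : ℕ} {Y : Type} [Fintype Y] (F : Kraus (Reg q) (Reg q) Y) :
    Kraus (Bits (Block q)) (Bits (Block q)) Y where
  ι := F.ι
  fin := F.fin
  op y i := embed Sum.inr (F.op y i)
  complete := by
    simp only [embed_conjTranspose, embed_mul Sum.inr_injective, sum_embed, F.complete, embed_one]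

theorem memoryKraus_map {q : ℕ} {Y : Type} [Fintype Y] (F : Kraus (Reg q) (Reg q) Y) (y : Y)
    (ρ : Matrix (Reg q) (Reg q) ℂ) :
    (memoryKraus F).toInstrument.map y (lift ρ) = lift (F.toInstrument.map y ρ) := by
  rw [Kraus.map_apply, Kraus.map_apply, ← sum_lift]
  exact Finset.sum_congr rfl fun i _ => embed_mul_lift_mul _ _

/-- The row vector which maps a block with measured qubit `c` to the amplitude of the outcome `b`,
when the qubit produced by `O` is measured in the basis `|±_α⟩`. -/
def measureRow {q : ℕ} (O : Matrix Bool (Reg q) ℂ) (α : Angle) (b c : Bool) :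
    Bits (Block q) → ℂ :=
  fun a => if a (.inl ()) = c then (basisChange α * O) b (fun j => a (.inr j)) else 0

/-- Produce the qubit, measure it in the basis `|±_α⟩`, store the outcome in the block, and
announce it if `r`. -/
def measureKraus {q : ℕ} (F : Kraus (Reg q) Bool Unit) (r : Bool) (α : Angle) :
    Kraus (Bits (Block q)) (Bits (Block q)) Bool where
  -- The indices are an operator of `F`, the result, and the previous value of the measured wire.
  -- Including the last makes the family complete on all block states, although lifted states only
  -- see the value 0. The memory is reset to zero, so each operator has rank one.
  ι := F.ι × Bool × Bool
  fin := inferInstance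
  op s i := if s = (r && i.2.1) then
    Matrix.vecMulVec (Pi.single (Sum.elim (fun _ => i.2.1) fun _ => false) 1)
      (measureRow (F.op () i.1) α i.2.1 i.2.2) else 0
  complete := by
    -- Completeness of `F` survives the change of basis because `basisChange` is unitary and cancels
    -- in each summand.
    have h0 (k l : Reg q) : ∑ i, ∑ b, star ((basisChange α * F.op () i) b k)
        * (basisChange α * F.op () i) b l = if k = l then 1 else 0 := by
      have h1 (i : F.ι) : (basisChange α * F.op () i)ᴴ * (basisChange α * F.op () i)
          = (F.op () i)ᴴ * F.op () i := by
        rw [Matrix.conjTranspose_mul, Matrix.mul_assoc, ← Matrix.mul_assoc (basisChange α)ᴴ,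
          basisChange_conjTranspose_mul, Matrix.one_mul]
      have h2 := F.complete
      simp only [Finset.univ_unique, Finset.sum_singleton] at h2
      have h3 := congrFun (congrFun h2 k) l
      simp only [PUnit.default_eq_unit, ← h1, Matrix.sum_apply, Matrix.one_apply] at h3
      rw [← h3]
      rfl
    rw [Finset.sum_comm]
    have hop (i : F.ι × Bool × Bool) (s : Bool) :
        (if s = (r && i.2.1) then Matrix.vecMulVec
          (Pi.single (Sum.elim (fun _ => i.2.1) fun _ => false) 1 : Bits (Block q) → ℂ)
          (measureRow (F.op () i.1) α i.2.1 i.2.2) else 0)ᴴ * (if s = (r && i.2.1) then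
          Matrix.vecMulVec (Pi.single (Sum.elim (fun _ => i.2.1) fun _ => false) 1)
          (measureRow (F.op () i.1) α i.2.1 i.2.2) else 0) = if s = (r && i.2.1) then
          Matrix.vecMulVec (star (measureRow (F.op () i.1) α i.2.1 i.2.2))
            (measureRow (F.op () i.1) α i.2.1 i.2.2) else 0 := by
      split_ifs
      · rw [Matrix.conjTranspose_vecMulVec, Matrix.vecMulVec_mul_vecMulVec]
        simp
      · simp
    simp only [hop, Finset.sum_ite_eq', Finset.mem_univ, if_true]
    ext a a'
    simp only [Matrix.sum_apply, Matrix.vecMulVec_apply, Pi.star_apply, Fintype.sum_prod_type]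
    have hrow (i : F.ι) (b : Bool) : ∑ c, star (measureRow (F.op () i) α b c a)
        * measureRow (F.op () i) α b c a'
        = if a (.inl ()) = a' (.inl ()) then star ((basisChange α * F.op () i) b
          fun j => a (.inr j)) * (basisChange α * F.op () i) b (fun j => a' (.inr j)) else 0 := by
      simp only [measureRow, Fintype.sum_bool]
      cases a (.inl ()) <;> cases a' (.inl ()) <;> simp
    simp only [hrow]
    by_cases h : a (.inl ()) = a' (.inl ())
    · simp only [h, if_true, h0, Matrix.one_apply]
      congr 1
      simp only [funext_iff, Sum.forall, eq_iff_iff]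
      exact ⟨fun h' => ⟨fun _ => h, h'⟩, fun h' => h'.2⟩
    · have hne : a ≠ a' := fun e => h (by rw [e])
      simp [h, hne]

theorem sum_block {q : ℕ} (f : Bits (Block q) → ℂ) :
    ∑ a, f a = ∑ b : Bool, ∑ k : Reg q, f (Sum.elim (fun _ => b) k) := by
  rw [sum_bits_sum, sum_bits_unit]

theorem measureRow_dotProduct_lift {q : ℕ} (O : Matrix Bool (Reg q) ℂ) (α : Angle) (b c : Bool)
    (ρ : Matrix (Reg q) (Reg q) ℂ) :
    (measureRow O α b c ᵥ* lift ρ) ⬝ᵥ star (measureRow O α b c)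
      = if c = false then (basisChange α * O * ρ * (basisChange α * O)ᴴ) b b else 0 := by
  unfold measureRow
  generalize basisChange α * O = M
  simp only [dotProduct, Matrix.vecMul, sum_block, Fintype.sum_bool, lift,
    Matrix.of_apply, Sum.elim_inl, Sum.elim_inr, Pi.star_apply]
  cases c
  · simp [Matrix.mul_apply]
  · simp

theorem vecMulVec_mul_mul_conjTranspose {H K : Type} [Fintype K] (u : H → ℂ)
    (v : K → ℂ) (X : Matrix K K ℂ) :
    Matrix.vecMulVec u v * X * (Matrix.vecMulVec u v)ᴴ
      = ((v ᵥ* X) ⬝ᵥ star v) • Matrix.vecMulVec u (star u) := by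
  rw [Matrix.vecMulVec_mul, Matrix.conjTranspose_vecMulVec, Matrix.vecMulVec_mul_vecMulVec,
    Matrix.vecMulVec_smul]

/-- On a lifted state only the operators with result `b` and previous value 0 contribute; their row
vectors give the diagonal entry at `b` of the output state in the measured basis, which is the
overlap. -/
theorem readProb_measureKraus {q : ℕ} (F : Kraus (Reg q) Bool Unit) (r : Bool) (α : Angle)
    (s b : Bool) (ρ : Matrix (Reg q) (Reg q) ℂ) :
    readProb b ((measureKraus F r α).toInstrument.map s (lift ρ))
      = if s = (r && b) then overlap (α + flipAngle b) (F.toInstrument.map () ρ) else 0 := by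
  have hsum : readProb b ((measureKraus F r α).toInstrument.map s (lift ρ))
      = ∑ i : F.ι × Bool × Bool,
        readProb b ((measureKraus F r α).op s i * lift ρ * ((measureKraus F r α).op s i)ᴴ) := by
    rw [Kraus.map_apply]
    unfold readProb
    rw [Finset.sum_comm]
    refine Finset.sum_congr rfl fun a _ => ?_
    split_ifs
    · rw [Matrix.sum_apply]
      rfl
    · simp
  have hread (i : F.ι) (m c : Bool) :
      readProb b ((measureKraus F r α).op s (i, m, c) * lift ρ *
        ((measureKraus F r α).op s (i, m, c))ᴴ)
      = if s = (r && m) ∧ m = b ∧ c = false then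
          (basisChange α * F.op () i * ρ * (basisChange α * F.op () i)ᴴ) b b else 0 := by
    change readProb b ((if s = (r && m) then _ else 0) * lift ρ *
      (if s = (r && m) then Matrix.vecMulVec _ _ else 0)ᴴ) = _
    by_cases h : s = (r && m)
    · rw [if_pos h, vecMulVec_mul_mul_conjTranspose, measureRow_dotProduct_lift]
      simp only [readProb, Matrix.smul_apply, Matrix.vecMulVec_apply]
      rw [Finset.sum_eq_single (Sum.elim (fun _ => m) fun _ => false)]
      · by_cases hm : m = b <;> cases c <;> simp [h, hm]
      · intro a _ ha
        simp [ha]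
      · simp
    · simp [h, readProb]
  rw [hsum, Fintype.sum_prod_type]
  simp only [Fintype.sum_prod_type, hread]
  have hF : overlap (α + flipAngle b) (F.toInstrument.map () ρ)
      = ∑ i, (basisChange α * F.op () i * ρ * (basisChange α * F.op () i)ᴴ) b b := by
    rw [overlap_eq_basisChange, Kraus.map_apply, Finset.mul_sum, Finset.sum_mul, Matrix.sum_apply]
    refine Finset.sum_congr rfl fun i _ => ?_
    rw [Matrix.conjTranspose_mul]
    simp only [Matrix.mul_assoc]
  rw [hF]
  cases b <;> by_cases h : s = r <;> simp [h]

/-- The blocks of an arbitrary server. -/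
def RSPServer.blocks {L m : ℕ} (B : RSPServer L m) (φ : Fin N → Angle) (w : Fin N) :
    Blocks N L m B.qubits where
  step t x := memoryKraus (B.respond t x).kraus
  angle v δ := measureKraus B.output.kraus (decide (v < w)) (δ - φ v)

theorem RSPServer.blocks_realizes {L m : ℕ} (B : RSPServer L m) (φ : Fin N → Angle) (w : Fin N) :
    (B.blocks φ w).Realizes B φ w where
  step t x y ρ := by
    rw [← (B.respond t x).kraus_map]
    exact memoryKraus_map _ _ _
  angle v δ s b ρ := by
    rw [attackProb, ← B.output.kraus_map]
    exact readProb_measureKraus _ _ _ _ _ _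

/-! ### Circuits -/

section Circuits

set_option linter.unusedSectionVars false

variable {U V W : Type} [Fintype U] [DecidableEq U] [Fintype V] [DecidableEq V] [Fintype W]
  [DecidableEq W]

theorem embed_comp {f : V → W} (hf : f.Injective) (g : U → V) (A : Matrix (Bits U) (Bits U) ℂ) :
    embed f (embed g A) = embed (fun u => f (g u)) A := by
  classical
  ext a b
  rw [embed_apply, embed_apply, embed_apply, ← ite_and]
  refine if_congr ⟨?_, fun h => ⟨fun w hw => h w ?_, fun v hv => h (f v) ?_⟩⟩ rfl rfl
  · rintro ⟨h1, h2⟩ w hw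
    by_cases hfw : w ∈ Set.range f
    · obtain ⟨v, rfl⟩ := hfw
      exact h2 v fun ⟨u, hu⟩ => hw ⟨u, congrArg f hu⟩
    · exact h1 w hfw
  · rintro ⟨u, rfl⟩
    exact hw ⟨g u, rfl⟩
  · rintro ⟨u, hu⟩
    exact hv ⟨u, hf hu⟩

theorem mul_embed_apply {K : Type} {f : V → W} (hf : f.Injective) (A : Matrix (Bits V) (Bits V) ℂ)
    (X : Matrix K (Bits W) ℂ) (a : K) (b : Bits W) :
    (X * embed f A) a b = ∑ c : Bits V, X a (Function.extend f c b) * A c fun v => b (f v) := by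
  have h := embed_mul_apply hf Aᴴ Xᴴ b a
  rw [← embed_conjTranspose, ← Matrix.conjTranspose_mul, Matrix.conjTranspose_apply] at h
  rw [← star_star ((X * embed f A) a b), h, star_sum]
  refine Finset.sum_congr rfl fun c _ => ?_
  rw [Matrix.conjTranspose_apply, Matrix.conjTranspose_apply, star_mul, star_star, star_star]

/-- The two wires of a gate. -/
def Gate.wires (g : Gate W) : Bool → W := fun c => if c then g.snd else g.fst

theorem Gate.wires_injective (g : Gate W) : g.wires.Injective := by
  intro a b h
  have := g.ne
  cases a <;> cases b <;> simp_all [Gate.wires]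

def Gate.localMatrix (g : Gate W) : Matrix (Bits Bool) (Bits Bool) ℂ :=
  g.mat.submatrix (Equiv.boolArrowEquivProd Bool) (Equiv.boolArrowEquivProd Bool)

theorem Gate.toMatrix_eq_embed (g : Gate W) : g.toMatrix = embed g.wires g.localMatrix := by
  classical
  ext a b
  rw [embed_apply, Gate.toMatrix, Matrix.of_apply]
  refine if_congr (forall_congr' fun w => ?_) rfl rfl
  simp only [Set.mem_range, Bool.exists_bool, Gate.wires]
  simp only [Bool.false_eq_true, if_false, if_true, not_or, and_imp, eq_comm, ne_eq]

theorem Gate.conjTranspose_toMatrix_mul (g : Gate W) : g.toMatrixᴴ * g.toMatrix = 1 := by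
  have h : g.matᴴ * g.mat = 1 := Matrix.mem_unitaryGroup_iff'.1 g.unitary
  rw [Gate.toMatrix_eq_embed, embed_conjTranspose, embed_mul g.wires_injective, Gate.localMatrix,
    Matrix.conjTranspose_submatrix, Matrix.submatrix_mul_equiv, h, Matrix.submatrix_one_equiv,
    embed_one]

theorem Circuit.toMatrix_nil : Circuit.toMatrix ([] : Circuit W) = 1 := rfl

theorem Circuit.toMatrix_cons (g : Gate W) (C : Circuit W) :
    Circuit.toMatrix (g :: C) = Circuit.toMatrix C * g.toMatrix := rfl

theorem Circuit.toMatrix_append (C D : Circuit W) :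
    Circuit.toMatrix (C ++ D) = Circuit.toMatrix D * Circuit.toMatrix C := by
  induction C with
  | nil => rw [List.nil_append, Circuit.toMatrix_nil, mul_one]
  | cons g C ih =>
    rw [List.cons_append, Circuit.toMatrix_cons, Circuit.toMatrix_cons, ih, mul_assoc]

theorem Circuit.conjTranspose_toMatrix_mul (C : Circuit W) : C.toMatrixᴴ * C.toMatrix = 1 := by
  induction C with
  | nil => rw [Circuit.toMatrix_nil, Matrix.conjTranspose_one, one_mul]
  | cons g C ih =>
    rw [Circuit.toMatrix_cons, Matrix.conjTranspose_mul, mul_assoc, ← mul_assoc _ _ g.toMatrix, ih,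
      one_mul, g.conjTranspose_toMatrix_mul]

/-- The gate with its wires renamed. -/
def Gate.rename {f : V → W} (hf : f.Injective) (g : Gate V) : Gate W where
  fst := f g.fst
  snd := f g.snd
  ne h := g.ne (hf h)
  mat := g.mat
  unitary := g.unitary

theorem Gate.toMatrix_rename {f : V → W} (hf : f.Injective) (g : Gate V) :
    (g.rename hf).toMatrix = embed f g.toMatrix := by
  rw [Gate.toMatrix_eq_embed, Gate.toMatrix_eq_embed, embed_comp hf]
  congr 1
  funext c
  cases c <;> rfl

/-- The circuit with its wires renamed. -/
def Circuit.rename {f : V → W} (hf : f.Injective) (C : Circuit V) : Circuit W :=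
  List.map (Gate.rename hf) C

theorem Circuit.length_rename {f : V → W} (hf : f.Injective) (C : Circuit V) :
    (C.rename hf).length = C.length := List.length_map _

theorem Circuit.toMatrix_rename {f : V → W} (hf : f.Injective) (C : Circuit V) :
    (C.rename hf).toMatrix = embed f C.toMatrix := by
  induction C with
  | nil => exact (embed_one f).symm
  | cons g C ih =>
    rw [Circuit.toMatrix_cons, ← embed_mul hf, ← ih, ← Gate.toMatrix_rename hf]
    rfl

/-- A family of circuits on disjoint sets of wires. -/
def Circuit.parallel {ι : Type} {f : ι → V → W} (hf : ∀ i, (f i).Injective) (C : ι → Circuit V)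
    (l : List ι) : Circuit W :=
  l.flatMap fun i => (C i).rename (hf i)

theorem Circuit.length_parallel {ι : Type} {f : ι → V → W} (hf : ∀ i, (f i).Injective)
    (C : ι → Circuit V) (l : List ι) :
    (Circuit.parallel hf C l).length = (l.map fun i => (C i).length).sum := by
  simp [Circuit.parallel, List.length_flatMap, Circuit.length_rename]

open Classical in
-- On disjoint wires matrix entries multiply, and untouched wires must agree. In the induction the
-- head circuit acts first, so it appears as the right factor.
theorem Circuit.toMatrix_parallel {ι : Type} {f : ι → V → W} (hf : ∀ i, (f i).Injective)
    (hdisj : ∀ i j v v', f i v = f j v' → i = j) (C : ι → Circuit V) (l : List ι) (hl : l.Nodup)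
    (a b : Bits W) :
    (Circuit.parallel hf C l).toMatrix a b
      = if ∀ w, (∀ i ∈ l, w ∉ Set.range (f i)) → a w = b w then
        (l.map fun i => (C i).toMatrix (fun v => a (f i v)) fun v => b (f i v)).prod else 0 := by
  induction l generalizing b with
  | nil =>
    change (1 : Matrix (Bits W) (Bits W) ℂ) a b = _
    simp [Matrix.one_apply, funext_iff]
  | cons i l ih =>
    obtain ⟨hi, hl'⟩ := List.nodup_cons.1 hl
    have h1 : Circuit.toMatrix (Circuit.parallel hf C (i :: l))
        = (Circuit.parallel hf C l).toMatrix * embed (f i) (C i).toMatrix := by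
      rw [← Circuit.toMatrix_rename (hf i), ← Circuit.toMatrix_append]
      rfl
    have hj : ∀ j ∈ l, ∀ (c : Bits V) v, Function.extend (f i) c b (f j v) = b (f j v) := by
      intro j hj c v
      refine Function.extend_apply' _ _ _ ?_
      rintro ⟨v', hv'⟩
      exact hi (hdisj _ _ _ _ hv' ▸ hj)
    have hprod (c : Bits V) : (l.map fun j => (C j).toMatrix (fun v => a (f j v))
          fun v => Function.extend (f i) c b (f j v)).prod
        = (l.map fun j => (C j).toMatrix (fun v => a (f j v)) fun v => b (f j v)).prod := by
      congr 1
      refine List.map_congr_left fun j hjl => ?_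
      simp only [hj j hjl c]
    -- The intermediate string on the wires of `i` is forced to be its final value, because the
    -- later circuits do not touch these wires; the sum over `c` thus has one term.
    have hcond (c : Bits V) : (∀ w, (∀ j ∈ l, w ∉ Set.range (f j)) →
          a w = Function.extend (f i) c b w)
        ↔ (c = fun v => a (f i v)) ∧ ∀ w, (∀ j ∈ i :: l, w ∉ Set.range (f j)) → a w = b w := by
      constructor
      · intro h
        constructor
        · funext v
          have := h (f i v) (fun j hjl ⟨v', hv'⟩ => hi (hdisj _ _ _ _ hv' ▸ hjl))
          rw [this, (hf i).extend_apply]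
        · intro w hw
          rw [h w fun j hjl => hw j (List.mem_cons_of_mem _ hjl)]
          exact Function.extend_apply' _ _ _ (hw i List.mem_cons_self)
      · rintro ⟨rfl, h⟩ w hw
        by_cases hwi : w ∈ Set.range (f i)
        · obtain ⟨v, rfl⟩ := hwi
          rw [(hf i).extend_apply]
        · rw [Function.extend_apply' _ _ _ hwi]
          refine h w fun j hjl => ?_
          rcases List.mem_cons.1 hjl with rfl | hjl
          · exact hwi
          · exact hw j hjl
    rw [h1, mul_embed_apply (hf i)]
    simp only [ih hl', hprod, hcond, ite_and, ite_mul, zero_mul]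
    rw [Finset.sum_ite_eq' , if_pos (Finset.mem_univ _)]
    simp only [List.map_cons, List.prod_cons]
    split_ifs
    · exact mul_comm _ _
    · rfl

/-! ### Circuit rounds as operator-sum families, and elementary gates. -/

/-- The operator-sum form of one round of a circuit machine. -/
def roundKraus {α β : Type} [Fintype α] [DecidableEq α] [Fintype β] [DecidableEq β]
    (C : Circuit (α ⊕ β ⊕ V)) (x : Bits α) : Kraus (Bits V) (Bits V) (Bits β) where
  ι := Bits α
  fin := inferInstance
  op y a := Matrix.of fun w' w =>
    C.toMatrix (Sum.elim a (Sum.elim y w')) (Sum.elim x (Sum.elim (fun _ => false) w))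
  complete := by
    -- Fixing the input register to `x` and the output register to zero selects columns of a
    -- unitary, and these remain orthonormal.
    ext w w₂
    have h := congrFun (congrFun C.conjTranspose_toMatrix_mul
      (Sum.elim x (Sum.elim (fun _ => false) w))) (Sum.elim x (Sum.elim (fun _ => false) w₂))
    rw [Matrix.mul_apply, sum_bits_sum] at h
    simp only [sum_bits_sum] at h
    rw [Finset.sum_comm]
    simp only [Matrix.sum_apply, Matrix.mul_apply, Matrix.conjTranspose_apply, Matrix.of_apply] at h ⊢
    rw [h, Matrix.one_apply, Matrix.one_apply]
    refine if_congr ⟨fun h => ?_, fun h => by rw [h]⟩ rfl rfl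
    funext v
    exact congrFun h (.inr (.inr v))

theorem roundKraus_map {α β : Type} [Fintype α] [DecidableEq α] [Fintype β] [DecidableEq β]
    {q : ℕ} (C : Circuit (α ⊕ β ⊕ Fin q)) (x : Bits α) (y : Bits β)
    (ρ : Matrix (Reg q) (Reg q) ℂ) : (roundKraus C x).toInstrument.map y ρ = C.roundMap x y ρ := rfl

/-- A gate that flips its first wire if `h` holds for the value of its second wire. -/
def flipGate {a b : W} (ne : a ≠ b) (h : Bool → Bool) : Gate W where
  fst := a
  snd := b
  ne := ne
  mat := Matrix.of fun p p' => if p.2 = p'.2 ∧ p.1 = xor p'.1 (h p'.2) then 1 else 0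
  unitary := by
    rw [Matrix.mem_unitaryGroup_iff']
    ext ⟨a, b⟩ ⟨a', b'⟩
    simp only [Matrix.mul_apply, Fintype.sum_prod_type, Fintype.sum_bool, Matrix.star_apply,
      Matrix.of_apply, Matrix.one_apply]
    cases hc : h true <;> cases hd : h false <;> cases a <;> cases b <;> cases a' <;> cases b' <;>
      simp [hc, hd]

theorem flipGate_toMatrix {a b : W} (ne : a ≠ b) (h : Bool → Bool) (x y : Bits W) :
    (flipGate ne h).toMatrix x y
      = if x = Function.update y a (xor (y a) (h (y b))) then 1 else 0 := by
  change (if ∀ w, w ≠ a → w ≠ b → x w = y w then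
    (if x b = y b ∧ x a = xor (y a) (h (y b)) then (1 : ℂ) else 0) else 0) = _
  rw [← ite_and]
  refine if_congr ⟨?_, ?_⟩ rfl rfl
  · rintro ⟨h1, h2, h3⟩
    funext w
    rcases eq_or_ne w a with rfl | hwa
    · rw [Function.update_self, h3]
    · rw [Function.update_of_ne hwa]
      rcases eq_or_ne w b with rfl | hwb
      · exact h2
      · exact h1 w hwa hwb
  · rintro rfl
    refine ⟨fun w hwa _ => Function.update_of_ne hwa _ _, Function.update_of_ne ne.symm _ _,
      Function.update_self _ _ _⟩

theorem mul_flipGate_toMatrix {K : Type} {a b : W} (ne : a ≠ b) (h : Bool → Bool)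
    (X : Matrix K (Bits W) ℂ) (x : K) (y : Bits W) :
    (X * (flipGate ne h).toMatrix) x y = X x (Function.update y a (xor (y a) (h (y b)))) := by
  simp [Matrix.mul_apply, flipGate_toMatrix]

/-- A gate that is diagonal in the computational basis. -/
def diagonalGate {a b : W} (ne : a ≠ b) (d : Bool × Bool → ℂ) (hd : ∀ p, star (d p) * d p = 1) :
    Gate W where
  fst := a
  snd := b
  ne := ne
  mat := Matrix.diagonal d
  unitary := by
    rw [Matrix.mem_unitaryGroup_iff', Matrix.star_eq_conjTranspose, Matrix.diagonal_conjTranspose,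
      Matrix.diagonal_mul_diagonal, ← Matrix.diagonal_one]
    congr 1
    funext p
    exact hd p

theorem diagonalGate_toMatrix {a b : W} (ne : a ≠ b) (d : Bool × Bool → ℂ)
    (hd : ∀ p, star (d p) * d p = 1) :
    (diagonalGate ne d hd).toMatrix = Matrix.diagonal fun x => d (x a, x b) := by
  ext x y
  change (if ∀ w, w ≠ a → w ≠ b → x w = y w then Matrix.diagonal d (x a, x b) (y a, y b) else 0) = _
  rw [Matrix.diagonal_apply, Matrix.diagonal_apply, ← ite_and]
  refine if_congr ⟨?_, ?_⟩ rfl rfl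
  · rintro ⟨h1, h2⟩
    funext w
    rcases eq_or_ne w a with rfl | hwa
    · exact congrArg Prod.fst h2
    · rcases eq_or_ne w b with rfl | hwb
      · exact congrArg Prod.snd h2
      · exact h1 w hwa hwb
  · rintro rfl
    simp

end Circuits

/-! ### The measurement circuit of a block -/

/-- Wires of the measurement round of one block: the angle, the announced bit, the block. -/
abbrev MeasureWire (q : ℕ) : Type := Fin 3 ⊕ Unit ⊕ Block q

/-- The phase `e^{-iα}` if `b` holds, and `1` otherwise. -/
def controlledPhase (α : Angle) (b : Bool) : ℂ := if b then star (phase α) else 1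

theorem star_controlledPhase_mul (α : Angle) (b : Bool) :
    star (controlledPhase α b) * controlledPhase α b = 1 := by
  rw [controlledPhase]
  split_ifs
  · rw [star_star, mul_comm, star_phase_mul]
  · simp

/-- The phase `e^{-iα}`, controlled by the bit `i` of the angle. -/
def phaseGate (q : ℕ) (i : Fin 3) (α : Angle) : Gate (MeasureWire q) :=
  diagonalGate (a := Sum.inl i) (b := Sum.inr (Sum.inr (Sum.inl ()))) Sum.inl_ne_inr
    (fun p => controlledPhase α (p.1 && p.2)) fun _ => star_controlledPhase_mul α _

/-- Change from the basis `|±_α⟩`, followed by a controlled-not onto the announced bit if `r`. -/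
def basisGate (q : ℕ) (r : Bool) (α : Angle) : Gate (MeasureWire q) where
  fst := .inr (.inr (.inl ()))
  snd := .inr (.inl ())
  ne := by simp
  mat := Matrix.of fun p p' => if p.2 = xor p'.2 (r && p.1) then basisChange α p.1 p'.1 else 0
  unitary := by
    rw [Matrix.mem_unitaryGroup_iff']
    ext ⟨a, s⟩ ⟨a', s'⟩
    have h := congrFun (congrFun (basisChange_conjTranspose_mul α) a) a'
    simp only [Matrix.mul_apply, Fintype.sum_bool, Matrix.conjTranspose_apply,
      Matrix.one_apply] at h
    simp only [Matrix.mul_apply, Fintype.sum_prod_type, Fintype.sum_bool, Matrix.star_apply,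
      Matrix.of_apply, Matrix.one_apply, Prod.mk.injEq]
    cases r <;> cases s <;> cases s' <;> simp at h ⊢ <;> exact h

/-- The circuit that produces the qubit of a server and measures it. -/
def measureCircuit {q : ℕ} (C : Circuit (Block q)) (r : Bool) (α : Angle) :
    Circuit (MeasureWire q) :=
  C.rename (Sum.inr_injective.comp Sum.inr_injective)
    ++ [phaseGate q 0 1, phaseGate q 1 2, phaseGate q 2 4, basisGate q r α]

theorem measureCircuit_length {q : ℕ} (C : Circuit (Block q)) (r : Bool) (α : Angle) :
    (measureCircuit C r α).length = C.length + 4 := by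
  simp [measureCircuit, Circuit.length_rename]

/-- The bits of `δ` carry the weights 1, 2, 4, so three bit-controlled phases compose to the phase
of `δ` itself. -/
theorem prod_phase_angleBits (δ : Angle) (d : Bool) :
    controlledPhase 1 (angleBits δ 0 && d) * (controlledPhase 2 (angleBits δ 1 && d) *
      controlledPhase 4 (angleBits δ 2 && d)) = controlledPhase δ d := by
  unfold controlledPhase
  cases d with
  | false => simp
  | true =>
    have h (b c : Bool) (α β : Angle) : ((if b then star (phase α) else 1)
        * (if c then star (phase β) else 1) : ℂ)
        = star (phase ((if b then α else 0) + if c then β else 0)) := by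
      rw [phase_add]
      cases b <;> cases c <;> simp [phase_zero]
    have h' (b : Bool) (α β : Angle) : ((if b then star (phase α) else 1)
        * star (phase β) : ℂ) = star (phase ((if b then α else 0) + β)) := by
      rw [phase_add]
      cases b <;> simp [phase_zero]
    simp only [Bool.and_true, if_true, h, h']
    congr 2
    revert δ
    decide

/-- Rotating the basis by `α` amounts to first applying the phase of `-α` to `|1⟩`. This separates
the received angle `δ`, handled by controlled phases, from `-φ v`, which is wired into the last
gate. -/
theorem basisChange_add (α β : Angle) (b d : Bool) :
    basisChange (α + β) b d = basisChange β b d * controlledPhase α d := by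
  simp only [controlledPhase, basisChange, Matrix.of_apply, plusKet_eq, add_assoc, phase_add α]
  cases d <;> simp
  ring

theorem phaseGates_toMatrix (q : ℕ) :
    (phaseGate q 2 4).toMatrix * ((phaseGate q 1 2).toMatrix * (phaseGate q 0 1).toMatrix)
      = Matrix.diagonal fun x => controlledPhase 1 (x (.inl 0) && x (.inr (.inr (.inl ())))) *
        (controlledPhase 2 (x (.inl 1) && x (.inr (.inr (.inl ())))) *
          controlledPhase 4 (x (.inl 2) && x (.inr (.inr (.inl ()))))) := by
  simp only [phaseGate, diagonalGate_toMatrix, Matrix.diagonal_mul_diagonal]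
  congr 1
  funext x
  ring

/-- The operator that sends the memory of a block to the amplitudes of the qubit produced by `C`,
when the remaining wires end up in `k`. -/
def outputOp {q : ℕ} (C : Circuit (Block q)) (k : Reg q) : Matrix Bool (Bits (Block q)) ℂ :=
  Matrix.of fun d w => C.toMatrix (Sum.elim (fun _ => d) k) w

/-- The angle register serves only as a control, so its final value must be `angleBits δ`; the
announced bit is a copy of the measured one, or 0 if `r` fails. -/
theorem roundKraus_measureCircuit {q : ℕ} (C : Circuit (Block q)) (r : Bool) (α δ : Angle)
    (s : Bool) (a : Bits (Fin 3)) (w' w : Bits (Block q)) :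
    (roundKraus (measureCircuit C r α) (angleBits δ)).op (fun _ => s) a w' w
      = if a = angleBits δ ∧ s = (r && w' (.inl ())) then
        (basisChange (δ + α) * outputOp C fun j => w' (.inr j)) (w' (.inl ())) w else 0 := by
  classical
  have hC : (measureCircuit C r α).toMatrix = (basisGate q r α).toMatrix *
      ((Matrix.diagonal fun x => controlledPhase 1 (x (.inl 0) && x (.inr (.inr (.inl ())))) *
        (controlledPhase 2 (x (.inl 1) && x (.inr (.inr (.inl ())))) *
          controlledPhase 4 (x (.inl 2) && x (.inr (.inr (.inl ())))))) *
        embed (fun j => Sum.inr (Sum.inr j)) C.toMatrix) := by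
    rw [measureCircuit, Circuit.toMatrix_append, Circuit.toMatrix_rename, ← phaseGates_toMatrix]
    simp only [Circuit.toMatrix_cons, Circuit.toMatrix_nil, one_mul, mul_assoc]
    rfl
  change (measureCircuit C r α).toMatrix (Sum.elim a (Sum.elim (fun _ => s) w'))
    (Sum.elim (angleBits δ) (Sum.elim (fun _ => false) w)) = _
  rw [hC, Matrix.mul_apply]
  simp only [sum_bits_sum, sum_bits_unit, Matrix.diagonal_mul, Sum.elim_inl, Sum.elim_inr]
  have hG (c₁ : Bits (Fin 3)) (c₂ d : Bool) (k : Reg q) :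
      (basisGate q r α).toMatrix (Sum.elim a (Sum.elim (fun _ : Unit => s) w'))
        (Sum.elim c₁ (Sum.elim (fun _ : Unit => c₂) (Sum.elim (fun _ => d) k)))
      = if c₁ = a then if k = (fun j => w' (.inr j)) then
          if s = xor c₂ (r && w' (.inl ())) then basisChange α (w' (.inl ())) d else 0
        else 0 else 0 := by
    rw [← ite_and]
    change (if _ then (if s = xor c₂ (r && w' (.inl ())) then basisChange α (w' (.inl ())) d
      else 0) else 0) = _
    refine if_congr ?_ rfl rfl
    simp only [basisGate, Sum.forall, Sum.elim_inl, Sum.elim_inr, funext_iff]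
    simp [eq_comm]
  have hE (c₁ : Bits (Fin 3)) (c₂ d : Bool) (k : Reg q) :
      embed (fun j => Sum.inr (Sum.inr j)) C.toMatrix
        (Sum.elim c₁ (Sum.elim (fun _ : Unit => c₂) (Sum.elim (fun _ => d) k)))
        (Sum.elim (angleBits δ) (Sum.elim (fun _ : Unit => false) w))
      = if c₂ = false then if c₁ = angleBits δ then
          C.toMatrix (Sum.elim (fun _ => d) k) w else 0 else 0 := by
    rw [← ite_and, embed_apply]
    refine if_congr ?_ rfl rfl
    simp [Sum.forall, funext_iff, and_comm]
  simp only [hG, hE]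
  rw [Finset.sum_eq_single a]
  · by_cases ha : a = angleBits δ
    · subst ha
      simp only [prod_phase_angleBits, if_true]
      simp [Matrix.mul_apply, outputOp, basisChange_add, mul_assoc]
    · simp [ha]
  · intro c₁ _ h
    simp [h]
  · simp

/-- The blocks of a server that is run by circuits. -/
def circuitBlocks {L m q : ℕ} (C : Fin L → Circuit (Fin m ⊕ Fin m ⊕ Fin q))
    (C' : Circuit (Block q)) (φ : Fin N → Angle) (w : Fin N) : Blocks N L m q where
  step t x := memoryKraus (roundKraus (C t) x)
  angle v δ :=
    { ι := Bits (Fin 3)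
      fin := inferInstance
      op := fun s => (roundKraus (measureCircuit C' (decide (v < w)) (-φ v))
        (angleBits δ)).op fun _ => s
      complete := by
        rw [← (roundKraus (measureCircuit C' (decide (v < w)) (-φ v)) (angleBits δ)).complete,
          ← (Equiv.funUnique Unit Bool).symm.sum_comp]
        rfl }

/-- A lifted state lives on the value 0 of the measured wire, so only those columns of `M` matter.
-/
theorem vecMul_lift_dotProduct {q : ℕ} (M : Matrix Bool (Bits (Block q)) ℂ) (b : Bool)
    (ρ : Matrix (Reg q) (Reg q) ℂ) :
    (M * lift ρ * Mᴴ) b b = (M.submatrix id (Sum.elim fun _ => false) * ρ *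
      (M.submatrix id (Sum.elim fun _ => false))ᴴ) b b := by
  simp only [Matrix.mul_apply, sum_block, Fintype.sum_bool, lift, Matrix.of_apply,
    Matrix.conjTranspose_apply, Matrix.submatrix_apply, Sum.elim_inl, Sum.elim_inr, id]
  simp

/-- Unlike `outputMap`, the measurement circuit leaves the final work memory in the block. Its basis
states play the role of the operator-sum index of `outputMap`, and `readProb` sums over them, so
tracing out later gives the same probabilities. -/
theorem circuitBlocks_realizes {L m : ℕ} (B : RSPServer L m)
    {C : Fin L → Circuit (Fin m ⊕ Fin m ⊕ Fin B.qubits)} {C' : Circuit (Unit ⊕ Fin B.qubits)}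
    (hC : ∀ t x y ρ, (B.respond t x).map y ρ = (C t).roundMap x y ρ)
    (hC' : ∀ ρ, B.output.map () ρ = C'.outputMap ρ) (φ : Fin N → Angle) (w : Fin N) :
    (circuitBlocks C C' φ w).Realizes B φ w where
  step t x y ρ := by
    rw [hC, ← roundKraus_map]
    exact memoryKraus_map _ _ _
  angle v δ s b ρ := by
    set r := decide (v < w) with hr
    have hO : B.output.map () ρ = ∑ k, (outputOp C' k).submatrix id (Sum.elim fun _ => false) * ρ *
        ((outputOp C' k).submatrix id (Sum.elim fun _ => false))ᴴ := hC' ρ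
    have hterm (a : Bits (Fin 3)) (w' : Bits (Block B.qubits)) :
        ((roundKraus (measureCircuit C' r (-φ v)) (angleBits δ)).op (fun _ => s) a * lift ρ *
          ((roundKraus (measureCircuit C' r (-φ v)) (angleBits δ)).op (fun _ => s) a)ᴴ) w' w'
        = if a = angleBits δ then if s = (r && w' (.inl ())) then
          (basisChange (δ - φ v) * ((outputOp C' fun j => w' (.inr j)).submatrix id
            (Sum.elim fun _ => false) * ρ * ((outputOp C' fun j => w' (.inr j)).submatrix id
            (Sum.elim fun _ => false))ᴴ) * (basisChange (δ - φ v))ᴴ) (w' (.inl ())) (w' (.inl ()))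
          else 0 else 0 := by
      have hM : basisChange (δ - φ v) * ((outputOp C' fun j => w' (.inr j)).submatrix id
            (Sum.elim fun _ => false) * ρ * ((outputOp C' fun j => w' (.inr j)).submatrix id
            (Sum.elim fun _ => false))ᴴ) * (basisChange (δ - φ v))ᴴ
          = (basisChange (δ - φ v) * outputOp C' fun j => w' (.inr j)).submatrix id
            (Sum.elim fun _ => false) * ρ * ((basisChange (δ - φ v) *
            outputOp C' fun j => w' (.inr j)).submatrix id (Sum.elim fun _ => false))ᴴ := by
        have : (basisChange (δ - φ v) * outputOp C' fun j => w' (.inr j)).submatrix id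
            (Sum.elim fun _ => false) = basisChange (δ - φ v) *
            (outputOp C' fun j => w' (.inr j)).submatrix id
              (Sum.elim fun _ : Unit => false : Reg B.qubits → Bits (Block B.qubits)) := rfl
        rw [this, Matrix.conjTranspose_mul]
        simp only [Matrix.mul_assoc]
      rw [hM, ← vecMul_lift_dotProduct, ← ite_and]
      simp only [Matrix.mul_apply, Matrix.conjTranspose_apply]
      simp only [roundKraus_measureCircuit, ← sub_eq_add_neg]
      split_ifs
      · rfl
      · simp
    rw [attackProb, ← hr, overlap_eq_basisChange, hO, Finset.mul_sum, Finset.sum_mul, Matrix.sum_apply]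
    have hread : readProb b (((circuitBlocks C C' φ w).angle v δ).toInstrument.map s (lift ρ))
        = ∑ w', if w' (.inl ()) = b then ∑ a : Bits (Fin 3),
          ((roundKraus (measureCircuit C' r (-φ v)) (angleBits δ)).op (fun _ => s) a * lift ρ *
          ((roundKraus (measureCircuit C' r (-φ v)) (angleBits δ)).op (fun _ => s) a)ᴴ) w' w'
          else 0 := by
      rw [readProb]
      refine Finset.sum_congr rfl fun w' _ => if_congr Iff.rfl ?_ rfl
      rw [Kraus.map_apply, Matrix.sum_apply]
      rfl
    rw [hread]
    simp only [hterm, Finset.sum_ite_eq', Finset.mem_univ, if_true, sum_block,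
      Sum.elim_inl, Sum.elim_inr, Fintype.sum_bool]
    cases b <;> simp

/-! ### The circuits of the distinguisher -/

theorem place_update_one_apply {q : ℕ} (v : Fin N)
    (K : Matrix (Bits (Block q)) (Bits (Block q)) ℂ) (a b : Reg (blockQubits N q)) :
    place (Function.update 1 v K) a b = if ∀ u, u ≠ v → split N q a u = split N q b u then
      K (split N q a v) (split N q b v) else 0 := by
  rw [place_apply, ← Finset.mul_prod_erase _ _ (Finset.mem_univ v), Function.update_self]
  have h : ∏ u ∈ Finset.univ.erase v, (Function.update (1 : Fin N → Matrix (Bits (Block q))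
      (Bits (Block q)) ℂ) v K u) (split N q a u) (split N q b u)
      = ∏ u ∈ Finset.univ.erase v, if split N q a u = split N q b u then 1 else 0 :=
    Finset.prod_congr rfl fun u hu => by
      rw [Function.update_of_ne (Finset.ne_of_mem_erase hu), Pi.one_apply, Matrix.one_apply]
  rw [h, Finset.prod_ite_zero]
  simp

/-- The measured wire of the block is left out, because a preparation round acts only on the
server's memory. -/
def prepareWires (N m q : ℕ) (v : Fin N) :
    Fin m ⊕ Fin m ⊕ Fin q → (Fin N × Fin m) ⊕ (Fin N × Fin m) ⊕ Fin (blockQubits N q) :=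
  Sum.map (Prod.mk v) (Sum.map (Prod.mk v) fun j => wire N q (v, .inr j))

theorem prepareWires_injective (N m q : ℕ) (v : Fin N) : (prepareWires N m q v).Injective :=
  (Prod.mk_right_injective v).sumMap ((Prod.mk_right_injective v).sumMap
    ((wire N q).injective.comp ((Prod.mk_right_injective v).comp Sum.inr_injective)))

theorem prepareWires_disjoint (N m q : ℕ) (u v : Fin N) (x y : Fin m ⊕ Fin m ⊕ Fin q)
    (h : prepareWires N m q u x = prepareWires N m q v y) : u = v := by
  rcases x with x | x | x <;> rcases y with y | y | y <;> simp_all [prepareWires]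

/-- `HasSize` demands equality on every state of the memory, not only on products of lifted ones.
The operators themselves are therefore matched, entry by entry. -/
theorem parallelKraus_memoryKraus_map {m q : ℕ} (C : Circuit (Fin m ⊕ Fin m ⊕ Fin q))
    (x y : Bits (Fin N × Fin m)) (ρ : Matrix (Reg (blockQubits N q)) (Reg (blockQubits N q)) ℂ) :
    (parallelKraus fun v => memoryKraus (roundKraus C fun j => x (v, j))).toInstrument.map y ρ
      = (Circuit.parallel (prepareWires_injective N m q) (fun _ => C)
          (List.finRange N)).roundMap x y ρ := by
  classical
  rw [← roundKraus_map, Kraus.map_apply, Kraus.map_apply]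
  change ∑ i : Fin N → Bits (Fin m), _ = ∑ a : Bits (Fin N × Fin m), _
  rw [← (Equiv.curry (Fin N) (Fin m) Bool).symm.sum_comp]
  have hop (i : Fin N → Bits (Fin m)) :
      (parallelKraus fun v => memoryKraus (roundKraus C fun j => x (v, j))).op y i
        = (roundKraus (Circuit.parallel (prepareWires_injective N m q) (fun _ => C)
          (List.finRange N)) x).op y ((Equiv.curry (Fin N) (Fin m) Bool).symm i) := by
    ext w' w
    change ∏ v, embed Sum.inr ((roundKraus C fun j => x (v, j)).op (fun j => y (v, j)) (i v))
      (split N q w' v) (split N q w v) = (Circuit.parallel (prepareWires_injective N m q)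
        (fun _ => C) (List.finRange N)).toMatrix _ _
    rw [Circuit.toMatrix_parallel (prepareWires_injective N m q) (prepareWires_disjoint N m q)
      _ _ (List.nodup_finRange N), ← Fin.prod_univ_def]
    simp only [embed_inr_apply, Finset.prod_ite_zero]
    have hcond : (∀ v ∈ Finset.univ, split N q w' v (.inl ()) = split N q w v (.inl ()))
        ↔ ∀ k, (∀ v ∈ List.finRange N, k ∉ Set.range (prepareWires N m q v)) →
          (Sum.elim ((Equiv.curry (Fin N) (Fin m) Bool).symm i) (Sum.elim y w') :
            Bits ((Fin N × Fin m) ⊕ (Fin N × Fin m) ⊕ Fin (blockQubits N q))) k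
          = Sum.elim x (Sum.elim (fun _ => false) w) k := by
      constructor
      · rintro h (⟨v, j⟩ | ⟨v, j⟩ | k) hk
        · exact absurd ⟨.inl j, rfl⟩ (hk v (List.mem_finRange v))
        · exact absurd ⟨.inr (.inl j), rfl⟩ (hk v (List.mem_finRange v))
        · obtain ⟨⟨v, j⟩, rfl⟩ := (wire N q).surjective k
          rcases j with j | j
          · exact h v (Finset.mem_univ v)
          · exact absurd ⟨.inr (.inr j), rfl⟩ (hk v (List.mem_finRange v))
      · intro h v _
        refine h (.inr (.inr (wire N q (v, .inl ())))) fun u _ => ?_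
        rintro ⟨x | x | x, hx⟩ <;> simp [prepareWires] at hx
    by_cases h : ∀ v ∈ Finset.univ, split N q w' v (.inl ()) = split N q w v (.inl ())
    · rw [if_pos h, if_pos (hcond.1 h)]
      refine Finset.prod_congr rfl fun v _ => ?_
      change C.toMatrix _ _ = _
      congr 1
      · funext k
        rcases k with k | k | k <;> rfl
      · funext k
        rcases k with k | k | k <;> rfl
    · rw [if_neg h, if_neg (fun h' => h (hcond.2 h'))]
  exact Finset.sum_congr rfl fun i _ => by rw [hop]

/-- The angle and answer registers are the same for all qubits, since these rounds are sequential;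
only the block depends on `v`. -/
def measureWires (N q : ℕ) (v : Fin N) : MeasureWire q → Fin 3 ⊕ Unit ⊕ Fin (blockQubits N q) :=
  Sum.map id (Sum.map id fun j => wire N q (v, j))

theorem measureWires_injective (N q : ℕ) (v : Fin N) : (measureWires N q v).Injective :=
  Function.injective_id.sumMap (Function.injective_id.sumMap
    ((wire N q).injective.comp (Prod.mk_right_injective v)))

theorem forall_notMem_measureWires {q : ℕ} {v : Fin N}
    {p : Fin 3 ⊕ Unit ⊕ Fin (blockQubits N q) → Prop} :
    (∀ k, k ∉ Set.range (measureWires N q v) → p k)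
      ↔ ∀ u, u ≠ v → ∀ j, p (.inr (.inr (wire N q (u, j)))) := by
  constructor
  · intro h u hu j
    refine h _ ?_
    rintro ⟨x | x | x, hx⟩ <;> simp [measureWires] at hx
    exact hu hx.1.symm
  · rintro h (k | k | k) hk
    · exact absurd ⟨.inl k, rfl⟩ hk
    · exact absurd ⟨.inr (.inl k), rfl⟩ hk
    · obtain ⟨⟨u, j⟩, rfl⟩ := (wire N q).surjective k
      refine h u ?_ j
      rintro rfl
      exact hk ⟨.inr (.inr j), rfl⟩

theorem roundKraus_rename_measureWires {q : ℕ} (C : Circuit (MeasureWire q)) (v : Fin N)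
    (x a : Bits (Fin 3)) (y : Bits Unit) :
    (roundKraus (C.rename (measureWires_injective N q v)) x).op y a
      = place (Function.update 1 v ((roundKraus C x).op y a)) := by
  classical
  ext w' w
  rw [place_update_one_apply]
  change Circuit.toMatrix _ _ _ = _
  rw [Circuit.toMatrix_rename, embed_apply]
  refine if_congr ?_ ?_ rfl
  · rw [forall_notMem_measureWires]
    refine forall₂_congr fun u _ => ?_
    rw [funext_iff]
    rfl
  · change _ = C.toMatrix _ _
    congr 1
    · funext k
      rcases k with k | k | k <;> rfl
    · funext k
      rcases k with k | k | k <;> rfl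

theorem roundMap_rename_measureWires {q : ℕ} (C : Circuit (MeasureWire q)) (v : Fin N)
    (x : Bits (Fin 3)) (y : Bits Unit)
    (ρ : Matrix (Reg (blockQubits N q)) (Reg (blockQubits N q)) ℂ) :
    Circuit.roundMap (C.rename (measureWires_injective N q v)) x y ρ
      = ∑ a : Bits (Fin 3), place (Function.update 1 v ((roundKraus C x).op y a)) * ρ *
        (place (Function.update 1 v ((roundKraus C x).op y a)))ᴴ := by
  rw [← roundKraus_map, Kraus.map_apply]
  exact Finset.sum_congr rfl fun a _ =>
    congrArg (fun K => K * ρ * Kᴴ) (roundKraus_rename_measureWires C v x a y)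

theorem angleBits_injective : Function.Injective angleBits := by
  unfold Function.Injective
  decide

theorem angleBits_testAngles (c : Bool) (w v : Fin N) (i : Fin 3) :
    angleBits (testAngles c w v) i = if (v, i) = (w, 1) then c else false := by
  -- The angle π/2 is encoded as 2, which in binary has only bit 1 set.
  have h2 : ∀ i, angleBits 2 i = decide (i = 1) := by decide
  have h0 : ∀ i, angleBits 0 i = false := by decide
  rw [testAngles]
  by_cases hv : v = w <;> cases c <;> by_cases hi : i = 1 <;> simp [hv, hi, h0, h2]

/-- The circuit that inputs the computation angles. -/
def chooseCircuit (Q : ℕ) (c : Bool) (w : Fin N) : Circuit (Empty ⊕ (Fin N × Fin 3) ⊕ Fin Q) :=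
  -- The flip is unconditional when `c` holds; the second wire is idle and only serves to make this
  -- a two-qubit gate.
  [flipGate (a := Sum.inr (Sum.inl (w, 1))) (b := Sum.inr (Sum.inl (w, 0))) (by simp) fun _ => c]

theorem roundMap_chooseCircuit (Q : ℕ) (c : Bool) (w : Fin N) (φ : Fin N → Angle)
    (ρ : Matrix (Reg Q) (Reg Q) ℂ) :
    (chooseCircuit Q c w).roundMap Empty.elim (fun i => angleBits (φ i.1) i.2) ρ
      = (if φ = testAngles c w then 1 else 0) * ρ * (if φ = testAngles c w then 1 else 0)ᴴ := by
  have hop (a : Bits Empty) : (roundKraus (chooseCircuit Q c w) Empty.elim).op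
      (fun i => angleBits (φ i.1) i.2) a = if φ = testAngles c w then 1 else 0 := by
    ext w' w₂
    change Circuit.toMatrix [_] (Sum.elim a (Sum.elim _ w')) (Sum.elim _ (Sum.elim _ w₂)) = _
    rw [Circuit.toMatrix_cons, Circuit.toMatrix_nil, one_mul, flipGate_toMatrix]
    have hiff : φ = testAngles c w ↔ ∀ i : Fin N × Fin 3,
        angleBits (φ i.1) i.2 = if i = (w, 1) then c else false := by
      constructor
      · rintro rfl i
        exact angleBits_testAngles c w i.1 i.2
      · intro h
        funext v
        refine angleBits_injective (funext fun i => ?_)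
        rw [h (v, i), angleBits_testAngles]
    rw [apply_ite (fun M : Matrix (Reg Q) (Reg Q) ℂ => M w' w₂), Matrix.one_apply,
      Matrix.zero_apply, ← ite_and]
    refine if_congr ?_ rfl rfl
    rw [hiff, funext_iff, Sum.forall, Sum.forall]
    simp [Function.update_apply, funext_iff]
  rw [← roundKraus_map, Kraus.map_apply]
  change ∑ a : Bits Empty, _ = _
  simp [hop]

/-- The circuit that compares the output bit of `w` with the value stored for it. -/
def guessCircuit (G : Pattern N) (w : {v : Fin N // v ∈ G.outputs}) (q : ℕ) :
    Circuit ({v : Fin N // v ∈ G.outputs} ⊕ Unit ⊕ Fin (blockQubits N q)) :=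
  -- Adding the output bit and then the negation of the stored bit to a zero wire leaves 1 exactly
  -- when the two bits agree.
  [flipGate (a := Sum.inr (Sum.inl ())) (b := Sum.inl w) Sum.inr_ne_inl id,
    flipGate (a := Sum.inr (Sum.inl ())) (b := Sum.inr (Sum.inr (wire N q (w.1, Sum.inl ()))))
      (by simp) not]

theorem roundMap_guessCircuit (G : Pattern N) (w : {v : Fin N // v ∈ G.outputs}) (q : ℕ)
    (out : G.Outcome) (b : Bool)
    (ρ : Matrix (Reg (blockQubits N q)) (Reg (blockQubits N q)) ℂ) :
    (guessCircuit G w q).roundMap out (fun _ => b) ρ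
      = (localKraus w.1 (checkKraus q (out w))).toInstrument.map b ρ := by
  have hop (a : G.Outcome) : (roundKraus (guessCircuit G w q) out).op (fun _ => b) a
      = if a = out then (localKraus w.1 (checkKraus q (out w))).op b () else 0 := by
    ext w' w₂
    change Circuit.toMatrix [_, _] (Sum.elim a (Sum.elim _ w')) (Sum.elim _ (Sum.elim _ w₂)) = _
    rw [Circuit.toMatrix_cons, Circuit.toMatrix_cons, Circuit.toMatrix_nil, one_mul,
      mul_flipGate_toMatrix, flipGate_toMatrix,
      apply_ite (fun M : Matrix (Reg (blockQubits N q)) (Reg (blockQubits N q)) ℂ => M w' w₂)]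
    change _ = if a = out then place (Function.update 1 w.1 (Matrix.diagonal _)) w' w₂ else 0
    rw [place_update_one_apply, Matrix.diagonal_apply]
    simp only [← ite_and]
    refine if_congr ⟨fun h => ?_, ?_⟩ rfl rfl
    · have h1 : w' = w₂ := funext fun k => (congrFun h (.inr (.inr k))).trans <| by
        rw [Function.update_of_ne (by simp), Function.update_of_ne (by simp)]
        rfl
      have h2 : b = (split N q w₂ w.1 (.inl ()) == out w) := by
        have := congrFun h (.inr (.inl ()))
        simp only [Sum.elim_inr, Sum.elim_inl, Function.update_self] at this
        rw [this]
        change xor (xor false (out w)) (!(split N q w₂ w.1 (.inl ()))) = _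
        cases out w <;> cases split N q w₂ w.1 (.inl ()) <;> rfl
      subst h1
      refine ⟨funext fun v => (congrFun h (.inl v)).trans ?_, fun _ _ => rfl, rfl, h2⟩
      rw [Function.update_of_ne (by simp), Function.update_of_ne (by simp)]
      rfl
    · rintro ⟨rfl, h1, h2, rfl⟩
      have h3 : w' = w₂ := (split N q).injective <| funext fun u => by
        rcases eq_or_ne u w.1 with rfl | hu
        · exact h2
        · exact h1 u hu
      subst h3
      funext k
      rcases k with k | k | k
      · rw [Function.update_of_ne (by simp), Function.update_of_ne (by simp)]
        rfl
      · simp only [Sum.elim_inr, Sum.elim_inl, Function.update_self]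
        change _ = xor (xor false (a w)) (!(split N q w' w.1 (.inl ())))
        cases a w <;> cases split N q w' w.1 (.inl ()) <;> rfl
      · rw [Function.update_of_ne (by simp), Function.update_of_ne (by simp)]
        rfl
  rw [← roundKraus_map, Kraus.map_apply, Kraus.map_apply]
  change ∑ a : G.Outcome, _ = ∑ i : Unit, _
  rw [Finset.sum_eq_single out]
  · simp [hop]
  · intro a _ ha
    simp [hop, ha]
  · simp

/-- Each block runs one copy of the server's circuits, which accounts for `N * s`; the number of
rounds is counted once more, giving another `s`. Per qubit there are one angle round, one measured
wire and four measurement gates, hence `6 * N`; the choice and the guess use three gates. -/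
theorem distinguisher_hasSize {L m q s : ℕ} (C : Fin L → Circuit (Fin m ⊕ Fin m ⊕ Fin q))
    (C' : Circuit (Block q)) (hs : L + m + q + ∑ t, (C t).length + C'.length ≤ s)
    (G : Pattern N) (w : {v : Fin N // v ∈ G.outputs}) (c : Bool) :
    ((circuitBlocks C C' (testAngles c w.1) w.1).distinguisher G (testAngles c w.1) w).HasSize
      ((N + 1) * s + 6 * N + 3) := by
  refine ⟨chooseCircuit _ c w, fun t => Circuit.parallel (prepareWires_injective N m q)
    (fun _ => C t) (List.finRange N), fun v => (measureCircuit C' (decide (v < w.1))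
    (-testAngles c w.1 v)).rename (measureWires_injective N q v), guessCircuit G w q,
    ?_, ?_, ?_, ?_, ?_⟩
  · intro φ ρ
    change Matrix (Reg (blockQubits N q)) (Reg (blockQubits N q)) ℂ at ρ
    refine Eq.trans ?_ (roundMap_chooseCircuit (blockQubits N q) c w.1 φ ρ).symm
    exact Fintype.sum_unique fun _ : Unit =>
      (if φ = testAngles c w.1 then (1 : Matrix (Reg (blockQubits N q)) _ ℂ) else 0) * ρ *
        (if φ = testAngles c w.1 then 1 else 0)ᴴ
  · intro t x y ρ
    exact parallelKraus_memoryKraus_map _ _ _ _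
  · intro v δ s ρ
    exact (roundMap_rename_measureWires _ _ _ _ _).symm
  · intro out b ρ
    exact (roundMap_guessCircuit G w q out b ρ).symm
  · have h3 : blockQubits N q = N * (1 + q) := by simp [blockQubits]
    have key : L + N * m + N + blockQubits N q + 1
        + ∑ t, (Circuit.parallel (prepareWires_injective N m q) (fun _ => C t)
          (List.finRange N)).length
        + ∑ v, ((measureCircuit C' (decide (v < w.1)) (-testAngles c w.1 v)).rename
          (measureWires_injective N q v)).length + 2 ≤ (N + 1) * s + 6 * N + 3 := by
      simp only [Circuit.length_parallel, Circuit.length_rename, measureCircuit_length, h3]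
      simp only [List.map_const', List.length_finRange, List.sum_replicate, smul_eq_mul,
        ← Finset.mul_sum, Finset.sum_const, Finset.card_univ, Fintype.card_fin]
      have h4 := Nat.mul_le_mul_left N hs
      have h5 : L ≤ s := by omega
      linarith [Nat.zero_le (N * L)]
    exact key

/-! ### The two impossibility statements. -/

theorem not_isSimulatorFor_unbounded {G : Pattern N} (hG : G.outputs.Nonempty)
    {P : ℕ → RSPProtocol} (hP : IsCorrectRSP P) (σ : ∀ n, Simulator G ((P n).iface N)) :
    ¬ IsSimulatorFor .unbounded G P σ := by
  intro h
  obtain ⟨w, hw⟩ := hG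
  exact not_negligible_advantages hP ⟨w, hw⟩ σ
    (fun c n => (P n).server.blocks_realizes (testAngles c w) w) fun c => h _ trivial

theorem not_isSimulatorFor_polynomial {G : Pattern N} (hG : G.outputs.Nonempty)
    {P : ℕ → RSPProtocol} (hP : IsCorrectRSP P) (hpoly : HasPolySizeServer P)
    (σ : ∀ n, Simulator G ((P n).iface N)) : ¬ IsSimulatorFor .polynomial G P σ := by
  intro h
  obtain ⟨w, hw⟩ := hG
  obtain ⟨p, hp⟩ := hpoly
  choose C C' hC hC' hs using hp
  refine not_negligible_advantages hP ⟨w, hw⟩ σ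
    (fun c n => circuitBlocks_realizes (P n).server (hC n) (hC' n) (testAngles c w) w)
    -- The graph is fixed, so `N` is a constant and the size bound is a polynomial in the security
    -- parameter.
    fun c => h _ ⟨(N + 1) * p + 6 * N + 3, fun n => ?_⟩
  have := distinguisher_hasSize (C n) (C' n) (hs n) G ⟨w, hw⟩ c
  simpa using this

end UBQC

end


theorem mainTheorem2 {N : ℕ} (G : UBQC.Pattern N) (hG : G.outputs.Nonempty)
    (P : ℕ → UBQC.RSPProtocol) (hP : UBQC.IsCorrectRSP P) :
    ((¬ ∃ σ : ∀ n, UBQC.Simulator G ((P n).iface N),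
        UBQC.IsSimulatorFor .unbounded G P σ) ∧
      ¬ UBQC.SecurelyConstructs .unbounded G P) ∧
    (UBQC.HasPolySizeServer P →
      (¬ ∃ σ : ∀ n, UBQC.Simulator G ((P n).iface N),
        UBQC.IsSimulatorFor .polynomial G P σ) ∧
      ¬ UBQC.SecurelyConstructs .polynomial G P) := by
  have h1 := fun σ => UBQC.not_isSimulatorFor_unbounded hG hP σ
  refine ⟨⟨fun ⟨σ, h⟩ => h1 σ h, fun ⟨_, σ, h⟩ => h1 σ h⟩, fun hpoly => ?_⟩
  have h2 := fun σ => UBQC.not_isSimulatorFor_polynomial hG hP hpoly σ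
  exact ⟨fun ⟨σ, h⟩ => h2 σ h, fun ⟨_, σ, h⟩ => h2 σ h⟩
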